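/- Let $\mathsf G$ be a connected simple Lie group with finite center, let $\mathsf K \le \mathsf G$ be a maximal compact subgroup, and suppose that $X = \mathsf G/\mathsf K$, endowed with some $\mathsf G$-invariant Riemannian metric, is isometric to the real hyperbolic plane $\mathbb H^2_{\mathbb R}$ (so $\mathsf G$ is automatically non-compact of rank one). Here a connected Lie group is simple if it is non-abelian and its only connected normal subgroups are the trivial subgroup and the whole group. Let $\tau \colon \mathsf G \to \mathrm{PGL}(d,\mathbb R)$ be a continuous homomorphism which is $\mathsf P_1$-proximal, i.e. there is $g \in \mathsf G$ such that, if $\lambda_1 \ge \lambda_2 \ge \dots \ge \lambda_d$ are the moduli of the complex eigenvalues, counted with algebraic multiplicity, of a matrix representing $\tau(g)$, then $\lambda_1 > \lambda_2$ (for $d=1$ this condition is vacuous; for $d = 0$ it is considered to fail). Let $$\mathbb R^d = \bigoplus_{j=1}^m V_j$$ be a decomposition into $\tau(\mathsf G)$-irreducible subspaces. Then there exists a properly convex domain $\Omega \subset \mathbf P(\mathbb R^d)$ (a non-empty open subset which is contained in some affine chart of $\mathbf P(\mathbb R^d)$ and is bounded and convex there) with $\tau(g)\,\Omega = \Omega$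 for all $g \in \mathsf G$ if and only if $\max_{1 \le j \le m} \dim V_j$ is odd. -/

import Mathlib

open scoped MatrixGroups Manifold ContDiff LinearAlgebra.Projectivization Matrix

namespace RankOneRep

/-- A connected group is *simple* in the sense of Lie theory: it is not abelian and has no connected
normal subgroup other than the trivial one and the whole group. -/
def IsSimpleLie (G : Type*) [Group G] [TopologicalSpace G] : Prop :=
  ConnectedSpace G ∧ (∃ a b : G, a * b ≠ b * a) ∧
    ∀ N : Subgroup G, N.Normal → IsConnected (N : Set G) → N = ⊥ ∨ N = ⊤

/-- `K` is a maximal element among the compact subgroups of `G`. -/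
def IsMaximalCompact {G : Type*} [Group G] [TopologicalSpace G] (K : Subgroup G) : Prop :=
  Maximal (fun L : Subgroup G => IsCompact (L : Set G)) K

/-- `X = G ⧸ K`, with a `G`-invariant Riemannian metric, is isometric to the real hyperbolic plane:
there is a homeomorphism `e` from `G ⧸ K` to the upper half plane, smooth as a function on `G`, for
which the distance pulled back by `e` from the hyperbolic distance is `G`-invariant. -/
def QuotientIsHyperbolicPlane {E : Type*} [NormedAddCommGroup E] [NormedSpace ℝ E]
    {G : Type*} [Group G] [TopologicalSpace G] [ChartedSpace E G] (K : Subgroup G) : Prop :=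
  ∃ e : (G ⧸ K) ≃ₜ UpperHalfPlane,
    ContMDiff 𝓘(ℝ, E) 𝓘(ℝ, ℂ) ∞ (fun g : G => e (QuotientGroup.mk g)) ∧
    ∀ (g : G) (x y : G ⧸ K), dist (e (g • x)) (e (g • y)) = dist (e x) (e y)

/-- The quotient topology on `PGL(d, ℝ)`. -/
instance instTopologicalSpacePGL (d : ℕ) :
    TopologicalSpace (Matrix.ProjGenLinGroup (Fin d) ℝ) :=
  TopologicalSpace.coinduced (Matrix.ProjGenLinGroup.mk : GL (Fin d) ℝ → _) inferInstance

/-- An element of `PGL(d, ℝ)` is `P₁`-proximal if for a matrix `A` representing it the moduli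
`λ₁ ≥ λ₂ ≥ ⋯ ≥ λ_d` of the complex eigenvalues of `A`, counted with algebraic multiplicity, satisfy
`λ₁ > λ₂`. (The condition does not depend on the choice of `A`.) -/
def IsProximal {d : ℕ} (g : Matrix.ProjGenLinGroup (Fin d) ℝ) : Prop :=
  ∃ A : GL (Fin d) ℝ, Matrix.ProjGenLinGroup.mk A = g ∧
    ∃ z ∈ ((A : Matrix (Fin d) (Fin d) ℝ).charpoly.map (algebraMap ℝ ℂ)).roots,
      ∀ w ∈ (((A : Matrix (Fin d) (Fin d) ℝ).charpoly.map (algebraMap ℝ ℂ)).roots.erase z),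
        ‖w‖ < ‖z‖

/-- The linear subspace `W` is mapped into itself by all elements of `S ⊆ PGL(d, ℝ)`. -/
def IsInvariantSubspace {d : ℕ} (S : Set (Matrix.ProjGenLinGroup (Fin d) ℝ))
    (W : Submodule ℝ (Fin d → ℝ)) : Prop :=
  ∀ A : GL (Fin d) ℝ, Matrix.ProjGenLinGroup.mk A ∈ S →
    ∀ v ∈ W, (A : Matrix (Fin d) (Fin d) ℝ) *ᵥ v ∈ W

/-- `W` is an `S`-irreducible subspace: it is nonzero and invariant, and has no invariant subspaces
other than `0` and itself. -/
def IsIrreducibleSubspace {d : ℕ} (S : Set (Matrix.ProjGenLinGroup (Fin d) ℝ))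
    (W : Submodule ℝ (Fin d → ℝ)) : Prop :=
  W ≠ ⊥ ∧ IsInvariantSubspace S W ∧
    ∀ U : Submodule ℝ (Fin d → ℝ), U ≤ W → IsInvariantSubspace S U → U = ⊥ ∨ U = W

/-- The vectors spanning a line that belongs to `Ω ⊆ P(ℝ^d)`. -/
def cone {d : ℕ} (Ω : Set (ℙ ℝ (Fin d → ℝ))) : Set (Fin d → ℝ) :=
  {v | ∃ hv : v ≠ 0, Projectivization.mk ℝ v hv ∈ Ω}

/-- A properly convex domain of `P(ℝ^d)`: a nonempty open set (for the quotient topology) which is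
a bounded convex subset of some affine chart. The affine charts are the complements of the
hyperplanes `P(ker f)`, for nonzero linear forms `f`, identified with the affine
hyperplanes `{v | f v = 1}`. -/
def IsProperlyConvexDomain {d : ℕ} (Ω : Set (ℙ ℝ (Fin d → ℝ))) : Prop :=
  Ω.Nonempty ∧ IsOpen (cone Ω) ∧
    ∃ f : (Fin d → ℝ) →ₗ[ℝ] ℝ, f ≠ 0 ∧ (∀ v ∈ cone Ω, f v ≠ 0) ∧
      Convex ℝ {v | f v = 1 ∧ v ∈ cone Ω} ∧ Bornology.IsBounded {v | f v = 1 ∧ v ∈ cone Ω}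

/-- `S ⊆ PGL(d, ℝ)` preserves some properly convex domain: `S` is contained in the automorphism
group `{g | g Ω = Ω}` of a properly convex domain `Ω`. -/
def PreservesProperlyConvexDomain {d : ℕ}
    (S : Set (Matrix.ProjGenLinGroup (Fin d) ℝ)) : Prop :=
  ∃ Ω : Set (ℙ ℝ (Fin d → ℝ)), IsProperlyConvexDomain Ω ∧
    ∀ g ∈ S, (fun p : ℙ ℝ (Fin d → ℝ) => g • p) '' Ω = Ω

end RankOneRep

/-!
Up to finite coverings, `G` is `SL(2, ℝ)`, and the theorem is a statement about representations of
`𝔰𝔩₂`.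

*Reduction to `𝔰𝔩₂`.* The group `G` acts on the upper half plane `ℍ` transitively, properly and by
isometries. Every isometry of `ℍ` is given by a matrix in `GL(2, ℝ)`
(`exists_GL_smul_eq_of_isometry`), and since `G` is perfect (`IsSimpleLie.commutator_eq_top`), its
elements act like matrices in `SL(2, ℝ)`. The group `actionPairs` of all pairs `(g, B)` acting in
the same way on `ℍ` covers `G` with finite kernel. It also covers `SL(2, ℝ)` with finite kernel: the
kernel acts trivially on `ℍ`, so it is central in `G`. The surjectivity onto `SL(2, ℝ)`
(`IsProperIsometricAction.surjective_pairSnd`) is obtained without the classification of Lie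
subgroups of `SL(2, ℝ)`: the image is a closed subgroup `R` that is transitive on `ℍ`, so it
contains `aₙ rₙ`, for diagonal matrices `aₙ` tending to infinity and bounded `rₙ`, and conjugation
by these elements expands suitable small elements of `R` to approximate any prescribed unipotent
upper triangular matrix.

The homomorphism to `PGL(d, ℝ)` lifts to the matrices of determinant `±1` over a further finite
covering. One-parameter groups lift through finite coverings (`exists_lift_oneParameter`), and so do
the relations between them (`eqOn_of_finite_ker`). The lifts of the upper and lower unipotent and of
the diagonal one-parameter group act on `ℝ^d` by `exp (s E)`, `exp (s F)` and `exp (s H)`, and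
differentiating the relations shows that `E`, `F`, `H` satisfy the relations of `𝔰𝔩₂`
(`exists_sl2Relations`). Hence the image of `G` in `PGL(d, ℝ)` is generated by the classes of
`exp (s E)` and `exp (s F)` (`IsProperIsometricAction.exists_isGeneratedBySl2`). No Lie algebra of
`G` is used.

*The criterion.* The irreducible subspaces are the symmetric powers of `ℝ²`, that of dimension
`N + 1` having highest weight `N`. Let `N` be the largest of the highest weights. On a vector `x`
with `F ^ N x ≠ 0`, the leading term of `exp (s F) x` is `s ^ N F ^ N x / N!`. If `N` is odd, it
changes its sign with `s`, and both `F ^ N x` and its negative would belong to the closure of the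
cone over an invariant domain, which contains no line
(`IsGeneratedBySl2.not_preservesProperlyConvexDomain`). If `N = 2 p` is even, let `f` be a linear
form that restricts to `a ^ N + b ^ N` on the orbit of the highest weight vector, parametrized by
`(a, b) ∈ ℝ²`. On the orbit of a suitable vector `x₀`, it grows at the rate `‖B‖ ^ N` for
`B ∈ SL(2, ℝ)`, which is the largest rate at which any vector can grow. The vectors `v` with
`‖A v‖ ≤ R f (A v)` for all `A` in the group therefore form an invariant convex cone which has
interior points if `R` is large (`IsGeneratedBySl2.preservesProperlyConvexDomain`).
-/

namespace RankOneRep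

/-! ### One-parameter groups of matrices -/

section Exponential

open scoped Matrix.Norms.Operator

variable {d : ℕ}

theorem hasDerivAt_matrix_mulVec {A : ℝ → Matrix (Fin d) (Fin d) ℝ}
    {A' : Matrix (Fin d) (Fin d) ℝ} {p : ℝ → Fin d → ℝ} {p' : Fin d → ℝ} {t : ℝ}
    (hA : HasDerivAt A A' t) (hp : HasDerivAt p p' t) :
    HasDerivAt (fun s => A s *ᵥ p s) (A' *ᵥ p t + A t *ᵥ p') t := by
  have hentry : ∀ i j, HasDerivAt (fun s => A s i j) (A' i j) t := fun i j =>
    (LinearMap.toContinuousLinearMap (Matrix.entryLinearMap ℝ ℝ i j :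
      Matrix (Fin d) (Fin d) ℝ →ₗ[ℝ] ℝ)).hasFDerivAt.comp_hasDerivAt t hA
  rw [hasDerivAt_pi]
  intro i
  have := HasDerivAt.fun_sum (u := Finset.univ)
    fun j _ => (hentry i j).mul ((hasDerivAt_pi.1 hp) j)
  simpa [Matrix.mulVec, dotProduct, Finset.sum_add_distrib] using this

theorem exp_neg_smul_mul_exp_smul {R : Type*} [NormedRing R] [NormedAlgebra ℝ R]
    [CompleteSpace R] (X : R) (t : ℝ) :
    NormedSpace.exp ((-t) • X) * NormedSpace.exp (t • X) = 1 := by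
  let _ : NormedAlgebra ℚ R := NormedAlgebra.restrictScalars ℚ ℝ R
  rw [← NormedSpace.exp_add_of_commute]
  · simp
  · exact ((Commute.refl X).smul_left _).smul_right _

theorem hasDerivAt_exp_neg_smul {R : Type*} [NormedRing R] [NormedAlgebra ℝ R]
    [CompleteSpace R] (X : R) (t : ℝ) :
    HasDerivAt (fun t : ℝ => NormedSpace.exp ((-t) • X)) (-(NormedSpace.exp ((-t) • X) * X)) t := by
  have := (hasDerivAt_exp_smul_const X (-t)).scomp t (hasDerivAt_neg t)
  rw [neg_one_smul] at this
  exact this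

/-- A solution of `p' = X p` is `p t = exp (t X) p 0`. -/
theorem exp_smul_mulVec_eq_of_hasDerivAt (X : Matrix (Fin d) (Fin d) ℝ) (p : ℝ → Fin d → ℝ)
    (hp : ∀ t, HasDerivAt p (X *ᵥ p t) t) (t : ℝ) :
    NormedSpace.exp (t • X) *ᵥ p 0 = p t := by
  have hd : ∀ s, HasDerivAt (fun s => NormedSpace.exp ((-s) • X) *ᵥ p s) 0 s := by
    intro s
    have := hasDerivAt_matrix_mulVec (hasDerivAt_exp_neg_smul X s) (hp s)
    rw [Matrix.neg_mulVec, Matrix.mulVec_mulVec, neg_add_cancel] at this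
    exact this
  have h := is_const_of_deriv_eq_zero (fun s => (hd s).differentiableAt) (fun s => (hd s).deriv)
    t 0
  simp only [neg_zero, zero_smul, NormedSpace.exp_zero, Matrix.one_mulVec] at h
  have h2 : NormedSpace.exp (t • X) * NormedSpace.exp ((-t) • X) = 1 := by
    have h3 := exp_neg_smul_mul_exp_smul X (-t)
    rwa [neg_neg] at h3
  rw [← h, Matrix.mulVec_mulVec, h2, Matrix.one_mulVec]

/-- A continuous one-parameter group in a Banach algebra is an exponential. -/
theorem exists_eq_exp_of_oneParameter {R : Type*} [NormedRing R] [NormedAlgebra ℝ R]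
    [CompleteSpace R] (A : ℝ → R) (hc : Continuous A) (h0 : A 0 = 1)
    (hm : ∀ s t, A (s + t) = A s * A t) :
    ∃ X : R, ∀ t, A t = NormedSpace.exp (t • X) := by
  -- `A t * ∫₀ᵃ A = ∫ₜ^{t+a} A` is differentiable in `t`, and `∫₀ᵃ A` is invertible for small `a`
  set J : ℝ → R := fun u => ∫ s in (0:ℝ)..u, A s with hJ
  have hJd : ∀ u, HasDerivAt J (A u) u := fun u => (hc.integral_hasStrictDerivAt 0 u).hasDerivAt
  have hJ0 : J 0 = 0 := by simp [hJ]
  have hlim : Filter.Tendsto (fun a : ℝ => a⁻¹ • J a) (nhdsWithin 0 {0}ᶜ) (nhds 1) := by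
    have := (hJd 0).tendsto_slope_zero
    simpa [hJ0, h0] using this
  obtain ⟨a, ha, hu⟩ : ∃ a : ℝ, a ≠ 0 ∧ IsUnit (a⁻¹ • J a) := by
    have h1 := hlim.eventually (Units.isOpen.mem_nhds (isUnit_one : IsUnit (1 : R)))
    obtain ⟨a, h2, h3⟩ := (h1.and self_mem_nhdsWithin).exists
    exact ⟨a, h3, h2⟩
  have huJ : IsUnit (J a) := by
    have := hu.mul ((isUnit_iff_ne_zero.2 ha).map (algebraMap ℝ R))
    rwa [← Algebra.commutes, ← Algebra.smul_def, smul_smul, mul_inv_cancel₀ ha, one_smul] at this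
  obtain ⟨U, hU⟩ := huJ
  have hAJ : ∀ t, A t * J a = J (t + a) - J t := by
    intro t
    have h1 : A t * J a = ∫ s in (0:ℝ)..a, A (t + s) := by
      simp_rw [hm, hJ]
      exact ((ContinuousLinearMap.mul ℝ R (A t)).intervalIntegral_comp_comm
        (hc.intervalIntegrable 0 a)).symm
    rw [h1, intervalIntegral.integral_comp_add_left (fun s => A s), hJ]
    simp only [add_zero]
    rw [intervalIntegral.integral_interval_sub_left] <;> exact hc.intervalIntegrable _ _
  have hA : A = fun t => (J (t + a) - J t) * ↑U⁻¹ := by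
    funext t
    rw [← hAJ, ← hU, mul_assoc, Units.mul_inv, mul_one]
  have hdiff : DifferentiableAt ℝ A 0 := by
    have h1 : HasDerivAt (fun t => J (t + a)) (A (0 + a)) 0 := (hJd (0 + a)).comp_add_const 0 a
    rw [hA]
    exact ((h1.sub (hJd 0)).mul_const _).differentiableAt
  set X := deriv A 0
  have hd0 : HasDerivAt A X 0 := hdiff.hasDerivAt
  have hd : ∀ t, HasDerivAt A (A t * X) t := by
    intro t
    have h1 : HasDerivAt (fun s => A (s + -t)) X t := by
      have := HasDerivAt.comp_add_const t (-t) (f := A) (f' := X) (by simpa using hd0)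
      exact this
    have h2 := h1.const_mul (A t)
    refine h2.congr_of_eventuallyEq (Filter.Eventually.of_forall fun s => ?_)
    simp [← hm]
  refine ⟨X, fun t => ?_⟩
  have hconst : ∀ t, A t * NormedSpace.exp ((-t) • X) = 1 := by
    intro t
    have h1 : ∀ t, HasDerivAt (fun t : ℝ => A t * NormedSpace.exp ((-t) • X)) 0 t := by
      intro t
      have h2 : HasDerivAt (fun t : ℝ => A t * NormedSpace.exp ((-t) • X)) _ t :=
        (hd t).mul (hasDerivAt_exp_neg_smul X t)
      have h3 : Commute X (NormedSpace.exp ((-t) • X)) :=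
        ((Commute.refl X).smul_right _).exp_right
      rwa [mul_neg, ← h3.eq, mul_assoc, add_neg_cancel] at h2
    have h3 := is_const_of_deriv_eq_zero (fun t => (h1 t).differentiableAt) (fun t => (h1 t).deriv)
      t 0
    simpa [h0] using h3
  calc A t = A t * (NormedSpace.exp ((-t) • X) * NormedSpace.exp (t • X)) := by
        rw [exp_neg_smul_mul_exp_smul, mul_one]
    _ = _ := by rw [← mul_assoc, hconst, one_mul]

theorem exists_eq_exp_of_oneParameter_GL (A : ℝ → GL (Fin d) ℝ) (hc : Continuous A)
    (hm : ∀ s t, A (s + t) = A s * A t) :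
    ∃ X : Matrix (Fin d) (Fin d) ℝ, ∀ t, (A t).val = NormedSpace.exp (t • X) := by
  apply exists_eq_exp_of_oneParameter (fun t => (A t).val)
  · exact Units.continuous_val.comp hc
  · have := hm 0 0
    simp at this
    simp [this]
  · simp [hm]

end Exponential
/-! ### Representations of `𝔰𝔩₂` -/

/-- The relations of the standard generators of `𝔰𝔩₂` for three endomorphisms. In contrast to
`IsSl2Triple`, the endomorphism `h` may vanish, as it does in a trivial representation. -/
structure Sl2Relations {W : Type*} [AddCommGroup W] [Module ℝ W] (e f h : Module.End ℝ W) :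
    Prop where
  h_e : ∀ x, h (e x) = e (h x) + (2 : ℝ) • e x
  h_f : ∀ x, h (f x) = f (h x) - (2 : ℝ) • f x
  e_f : ∀ x, e (f x) = f (e x) + h x

/-- `w` is a highest weight vector of weight `N`, for the natural number `N` such that
`w, f w, …, f ^ N w` are nonzero and `f ^ (N + 1) w = 0`. -/
structure IsHighestWeight {W : Type*} [AddCommGroup W] [Module ℝ W] (e f h : Module.End ℝ W)
    (w : W) (N : ℕ) : Prop where
  e_eq : e w = 0
  h_eq : h w = (N : ℝ) • w
  f_ne : (f ^ N) w ≠ 0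
  f_eq : (f ^ (N + 1)) w = 0

section Algebra

variable {W : Type*} [AddCommGroup W] [Module ℝ W] {e f h : Module.End ℝ W}

/-- An endomorphism `a` with `[h, a] = c a`, `c ≠ 0`, is nilpotent: its nonzero powers are
eigenvectors of `ad h` for distinct eigenvalues. -/
theorem isNilpotent_of_commutator_eq [FiniteDimensional ℝ W] {a h : Module.End ℝ W} {c : ℝ}
    (hc : c ≠ 0) (ha : ∀ x, h (a x) = a (h x) + c • a x) : IsNilpotent a := by
  by_contra hn
  have hne : ∀ k, a ^ k ≠ 0 := fun k hk => hn ⟨k, hk⟩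
  let T : Module.End ℝ (Module.End ℝ W) := LinearMap.mulLeft ℝ h - LinearMap.mulRight ℝ h
  have ha' : h * a = a * h + c • a := LinearMap.ext ha
  have hT : ∀ k : ℕ, T (a ^ k) = ((k : ℝ) * c) • a ^ k := by
    intro k
    have : h * a ^ k = a ^ k * h + ((k : ℝ) * c) • a ^ k := by
      induction k with
      | zero => simp
      | succ k ih =>
        rw [pow_succ, ← mul_assoc, ih, add_mul, mul_assoc, ha', mul_add, smul_mul_assoc,
          mul_smul_comm, mul_assoc, add_assoc, ← add_smul]
        congr 2
        push_cast
        ring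
    simp [T, this]
  have hev : ∀ k : ℕ, Module.End.HasEigenvalue T ((k : ℝ) * c) := fun k =>
    Module.End.hasEigenvalue_of_hasEigenvector
      ⟨Module.End.mem_eigenspace_iff.2 (hT k), hne k⟩
  have hfin := Module.End.finite_hasEigenvalue T
  refine Set.infinite_of_injective_forall_mem (f := fun k : ℕ => (k : ℝ) * c) ?_ hev hfin
  intro i j hij
  simpa [hc] using hij

namespace Sl2Relations

variable (S : Sl2Relations e f h)
include S

theorem isNilpotent_e [FiniteDimensional ℝ W] : IsNilpotent e :=
  isNilpotent_of_commutator_eq two_ne_zero S.h_e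

theorem isNilpotent_f [FiniteDimensional ℝ W] : IsNilpotent f :=
  isNilpotent_of_commutator_eq (c := -2) (by norm_num) (h := h)
    fun x => by rw [S.h_f, neg_smul, sub_eq_add_neg]

theorem h_f_pow (k : ℕ) (x : W) :
    h ((f ^ k) x) = (f ^ k) (h x) - (2 * k : ℝ) • (f ^ k) x := by
  induction k with
  | zero => simp
  | succ k ih =>
    rw [pow_succ', Module.End.mul_apply, S.h_f, ih, map_sub, map_smul, Module.End.mul_apply]
    push_cast
    module

theorem e_f_pow (k : ℕ) {x : W} (hx : e x = 0) :
    e ((f ^ (k + 1)) x) = (k + 1 : ℝ) • (f ^ k) (h x - (k : ℝ) • x) := by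
  induction k with
  | zero => simp [S.e_f, hx]
  | succ k ih =>
    rw [pow_succ', Module.End.mul_apply, S.e_f, ih, S.h_f_pow, map_smul, ← Module.End.mul_apply,
      ← pow_succ', map_sub, map_sub, map_smul, map_smul]
    push_cast
    module

/-- Every nonzero invariant subspace contains a real eigenvector of `h` in the kernel of `e`. On
that kernel `e ^ m f ^ m = m! ∏_{i < m} (h - i)`, which vanishes for large `m`. -/
theorem exists_eigenvector {V : Submodule ℝ W} (hVh : ∀ x ∈ V, h x ∈ V) (m : ℕ) :
    ∀ x ∈ V, x ≠ 0 → e x = 0 → (e ^ m) ((f ^ m) x) = 0 →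
      ∃ w ∈ V, w ≠ 0 ∧ e w = 0 ∧ ∃ c : ℝ, h w = c • w := by
  induction m with
  | zero => intro x _ hx _ h0; simp [hx] at h0
  | succ m ih =>
    intro x hxV hx hex h0
    by_cases hy : h x - (m : ℝ) • x = 0
    · exact ⟨x, hxV, hx, hex, m, sub_eq_zero.1 hy⟩
    · refine ih _ (V.sub_mem (hVh x hxV) (V.smul_mem _ hxV)) hy ?_ ?_
      · have := S.h_e x
        rw [hex] at this
        simp only [map_zero, smul_zero, add_zero] at this
        simp [hex, ← this]
      · rw [pow_succ, Module.End.mul_apply, S.e_f_pow m hex, map_smul, smul_eq_zero] at h0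
        exact h0.resolve_left (by positivity)

/-- Invariant subspaces contain highest weight vectors. The weight is the natural number `N` with
`f ^ N w ≠ 0 = f ^ (N + 1) w`, because `e f ^ (N + 1) w = (N + 1) (c - N) f ^ N w` if
`h w = c w`. -/
theorem exists_isHighestWeight [FiniteDimensional ℝ W] {V : Submodule ℝ W} (hV : V ≠ ⊥)
    (hVe : ∀ x ∈ V, e x ∈ V) (hVh : ∀ x ∈ V, h x ∈ V) :
    ∃ w ∈ V, ∃ N, IsHighestWeight e f h w N := by
  obtain ⟨v, hvV, hv⟩ := V.exists_mem_ne_zero_of_ne_bot hV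
  obtain ⟨x, hxV, hx, hex⟩ : ∃ x ∈ V, x ≠ 0 ∧ e x = 0 := by
    obtain ⟨n, hn⟩ := S.isNilpotent_e
    have hex : ∃ n, (e ^ n) v = 0 := ⟨n, by simp [hn]⟩
    classical
    have h1 := Nat.find_spec hex
    have h2 : Nat.find hex ≠ 0 := fun h => by rw [h] at h1; exact hv h1
    obtain ⟨k, hk⟩ := Nat.exists_eq_succ_of_ne_zero h2
    refine ⟨(e ^ k) v, ?_, Nat.find_min hex (by omega), ?_⟩
    · clear * - hvV hVe
      induction k with
      | zero => exact hvV
      | succ k ih => rw [pow_succ', Module.End.mul_apply]; exact hVe _ ih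
    · rw [hk, Nat.succ_eq_add_one, pow_succ', Module.End.mul_apply] at h1
      exact h1
  obtain ⟨m, hm⟩ := S.isNilpotent_f
  obtain ⟨w, hwV, hw, hew, c, hc⟩ := S.exists_eigenvector hVh m x hxV hx hex (by simp [hm])
  have hex : ∃ n, (f ^ n) w = 0 := ⟨m, by simp [hm]⟩
  classical
  have h1 := Nat.find_spec hex
  have h2 : Nat.find hex ≠ 0 := fun h => by rw [h] at h1; exact hw h1
  obtain ⟨N, hN⟩ := Nat.exists_eq_succ_of_ne_zero h2
  have hfN : (f ^ N) w ≠ 0 := Nat.find_min hex (by omega)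
  rw [hN, Nat.succ_eq_add_one] at h1
  have h3 := S.e_f_pow N hew
  rw [h1, map_zero, hc, ← sub_smul, map_smul, smul_smul] at h3
  have h4 := (smul_eq_zero.1 h3.symm).resolve_right hfN
  have h5 : c = N := by
    rcases mul_eq_zero.1 h4 with h | h
    · exact absurd h (by positivity)
    · linarith
  exact ⟨w, hwV, N, hew, h5 ▸ hc, hfN, h1⟩

end Sl2Relations

namespace IsHighestWeight

variable (S : Sl2Relations e f h) {w : W} {N : ℕ} (hw : IsHighestWeight e f h w N)
include hw

theorem f_pow_ne_zero {k : ℕ} (hk : k ≤ N) : (f ^ k) w ≠ 0 := by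
  intro h0
  apply hw.f_ne
  rw [← Nat.sub_add_cancel hk, pow_add, Module.End.mul_apply, h0, map_zero]

theorem f_pow_eq_zero {k : ℕ} (hk : N < k) : (f ^ k) w = 0 := by
  rw [← Nat.sub_add_cancel (Nat.succ_le_of_lt hk), pow_add, Module.End.mul_apply,
    Nat.succ_eq_add_one, hw.f_eq, map_zero]

include S

theorem h_f_pow (k : ℕ) : h ((f ^ k) w) = ((N : ℝ) - 2 * k) • (f ^ k) w := by
  rw [S.h_f_pow, hw.h_eq, map_smul, sub_smul]

theorem e_f_pow (k : ℕ) :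
    e ((f ^ (k + 1)) w) = ((k + 1 : ℝ) * (N - k)) • (f ^ k) w := by
  rw [S.e_f_pow k hw.e_eq, hw.h_eq, ← sub_smul, map_smul, smul_smul]

theorem linearIndependent : LinearIndependent ℝ fun k : Fin (N + 1) => (f ^ (k : ℕ)) w := by
  refine Module.End.eigenvectors_linearIndependent' h (fun k : Fin (N + 1) => (N : ℝ) - 2 * k)
    ?_ _ fun k => ⟨Module.End.mem_eigenspace_iff.2 (hw.h_f_pow S k),
      hw.f_pow_ne_zero (Nat.lt_succ_iff.1 k.2)⟩
  intro i j hij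
  have : (i : ℝ) = j := by simpa using hij
  exact Fin.ext (by exact_mod_cast this)

theorem span_eq {V : Submodule ℝ W} (hwV : w ∈ V) (hVf : ∀ x ∈ V, f x ∈ V)
    (hirr : ∀ U ≤ V, (∀ x ∈ U, e x ∈ U) → (∀ x ∈ U, f x ∈ U) → U = ⊥ ∨ U = V) :
    Submodule.span ℝ (Set.range fun k : Fin (N + 1) => (f ^ (k : ℕ)) w) = V := by
  have hmem : ∀ k, (f ^ k) w ∈
      Submodule.span ℝ (Set.range fun k : Fin (N + 1) => (f ^ (k : ℕ)) w) := by
    intro k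
    by_cases hk : k ≤ N
    · exact Submodule.subset_span ⟨⟨k, Nat.lt_succ_of_le hk⟩, rfl⟩
    · rw [hw.f_pow_eq_zero (not_le.1 hk)]; exact Submodule.zero_mem _
  refine (hirr _ ?_ ?_ ?_).resolve_left ?_
  · rw [Submodule.span_le]
    have hV : ∀ k : ℕ, (f ^ k) w ∈ V := by
      intro k
      induction k with
      | zero => exact hwV
      | succ k ih => rw [pow_succ', Module.End.mul_apply]; exact hVf _ ih
    rintro _ ⟨k, rfl⟩
    exact hV k
  · intro x hx
    induction hx using Submodule.span_induction with
    | mem x hx =>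
      obtain ⟨k, rfl⟩ := hx
      rcases k with ⟨_ | k, hk⟩
      · simp [hw.e_eq]
      · simp only [hw.e_f_pow S]
        exact Submodule.smul_mem _ _ (hmem k)
    | zero => simp
    | add x y _ _ hx hy => rw [map_add]; exact Submodule.add_mem _ hx hy
    | smul c x _ hx => rw [map_smul]; exact Submodule.smul_mem _ _ hx
  · intro x hx
    induction hx using Submodule.span_induction with
    | mem x hx =>
      obtain ⟨k, rfl⟩ := hx
      have := hmem (k + 1)
      rwa [pow_succ', Module.End.mul_apply] at this
    | zero => simp
    | add x y _ _ hx hy => rw [map_add]; exact Submodule.add_mem _ hx hy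
    | smul c x _ hx => rw [map_smul]; exact Submodule.smul_mem _ _ hx
  · intro h0
    have := hmem 0
    rw [h0, Submodule.mem_bot] at this
    exact hw.f_pow_ne_zero (Nat.zero_le N) this

theorem finrank_eq {V : Submodule ℝ W}
    (hspan : Submodule.span ℝ (Set.range fun k : Fin (N + 1) => (f ^ (k : ℕ)) w) = V) :
    Module.finrank ℝ V = N + 1 := by
  rw [← hspan, finrank_span_eq_card (hw.linearIndependent S), Fintype.card_fin]

omit S in
theorem f_pow_succ_eq_zero {V : Submodule ℝ W}
    (hspan : Submodule.span ℝ (Set.range fun k : Fin (N + 1) => (f ^ (k : ℕ)) w) = V)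
    {x : W} (hx : x ∈ V) : (f ^ (N + 1)) x = 0 := by
  rw [← hspan] at hx
  induction hx using Submodule.span_induction with
  | mem x hx =>
    obtain ⟨k, rfl⟩ := hx
    simp only
    rw [← Module.End.mul_apply, ← pow_add]
    exact hw.f_pow_eq_zero (by omega)
  | zero => simp
  | add x y _ _ hx hy => rw [map_add, hx, hy, add_zero]
  | smul c x _ hx => rw [map_smul, hx, smul_zero]

end IsHighestWeight

/-- The Veronese map `ℝ² → W` of degree `N`, in the coordinates `f ^ k w / k!`. If `w` is a
highest weight vector of weight `N`, it identifies the span of these vectors with the `N`-th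
symmetric power of `ℝ²`. -/
noncomputable def veronese (f : Module.End ℝ W) (w : W) (N : ℕ) (x y : ℝ) : W :=
  ∑ k ∈ Finset.range (N + 1), (x ^ (N - k) * y ^ k / k.factorial) • (f ^ k) w

theorem IsHighestWeight.f_veronese {w : W} {N : ℕ} (hw : IsHighestWeight e f h w N) (x y : ℝ) :
    f (veronese f w N x y) = ∑ k ∈ Finset.range (N + 1),
      (x ^ (N - k) * (k * y ^ (k - 1) * x) / k.factorial) • (f ^ k) w := by
  rw [veronese, map_sum, Finset.sum_range_succ, Finset.sum_range_succ' _ N, map_smul,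
    ← Module.End.mul_apply, ← pow_succ', hw.f_eq]
  simp only [smul_zero, add_zero, Nat.cast_zero, zero_mul, mul_zero, zero_div, zero_smul]
  refine Finset.sum_congr rfl fun k hk => ?_
  have hk' := Finset.mem_range.1 hk
  rw [map_smul, ← Module.End.mul_apply, ← pow_succ', Nat.add_sub_cancel, Nat.factorial_succ]
  congr 1
  rw [show N - k = N - (k + 1) + 1 by omega, pow_succ]
  push_cast
  field_simp

theorem IsHighestWeight.e_veronese (S : Sl2Relations e f h) {w : W} {N : ℕ}
    (hw : IsHighestWeight e f h w N) (x y : ℝ) :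
    e (veronese f w N x y) = ∑ k ∈ Finset.range (N + 1),
      (((N - k : ℕ) * x ^ (N - k - 1) * y) * y ^ k / k.factorial) • (f ^ k) w := by
  rw [veronese, map_sum, Finset.sum_range_succ', Finset.sum_range_succ]
  simp only [map_smul, pow_zero, Module.End.one_apply, hw.e_eq, smul_zero, add_zero,
    Nat.sub_self, Nat.cast_zero, zero_mul, zero_div, zero_smul]
  refine Finset.sum_congr rfl fun k hk => ?_
  have hk' := Finset.mem_range.1 hk
  rw [hw.e_f_pow S, smul_smul, Nat.factorial_succ, Nat.sub_sub, Nat.cast_sub hk'.le]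
  congr 1
  push_cast
  field_simp
  ring

end Algebra
/-! ### Exponentials and symmetric powers -/

section Veronese

variable {d : ℕ} {E F H : Matrix (Fin d) (Fin d) ℝ}

/-- Under the Veronese map, `exp (s E)` is the action of `!![1, s; 0, 1]` on `ℝ²`. -/
theorem exp_e_mulVec_veronese (S : Sl2Relations E.mulVecLin F.mulVecLin H.mulVecLin)
    {w : Fin d → ℝ} {N : ℕ} (hw : IsHighestWeight E.mulVecLin F.mulVecLin H.mulVecLin w N)
    (s x y : ℝ) :
    NormedSpace.exp (s • E) *ᵥ veronese F.mulVecLin w N x y =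
      veronese F.mulVecLin w N (x + s * y) y := by
  have := exp_smul_mulVec_eq_of_hasDerivAt E
    (fun t => veronese F.mulVecLin w N (x + t * y) y) (fun t => ?_) s
  · simpa using this
  · rw [← Matrix.mulVecLin_apply, hw.e_veronese S]
    refine HasDerivAt.fun_sum fun k _ => HasDerivAt.smul_const (HasDerivAt.div_const
      (HasDerivAt.mul_const ?_ _) _) _
    have := (((hasDerivAt_id t).mul_const y).const_add x).fun_pow (N - k)
    simpa using this

/-- Under the Veronese map, `exp (s F)` is the action of `!![1, 0; s, 1]` on `ℝ²`. -/
theorem exp_f_mulVec_veronese {w : Fin d → ℝ} {N : ℕ}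
    (hw : IsHighestWeight E.mulVecLin F.mulVecLin H.mulVecLin w N) (s x y : ℝ) :
    NormedSpace.exp (s • F) *ᵥ veronese F.mulVecLin w N x y =
      veronese F.mulVecLin w N x (y + s * x) := by
  have := exp_smul_mulVec_eq_of_hasDerivAt F
    (fun t => veronese F.mulVecLin w N x (y + t * x)) (fun t => ?_) s
  · simpa using this
  · rw [← Matrix.mulVecLin_apply, hw.f_veronese]
    refine HasDerivAt.fun_sum fun k _ => HasDerivAt.smul_const (HasDerivAt.div_const
      (HasDerivAt.const_mul _ ?_) _) _
    have := (((hasDerivAt_id t).mul_const x).const_add y).fun_pow k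
    simpa using this

/-- `exp (s F)` is polynomial in `s` on a vector killed by `F ^ (N + 1)`. -/
theorem exp_smul_mulVec_eq_sum {N : ℕ} {x : Fin d → ℝ} (hx : (F.mulVecLin ^ (N + 1)) x = 0)
    (s : ℝ) :
    NormedSpace.exp (s • F) *ᵥ x =
      ∑ k ∈ Finset.range (N + 1), (s ^ k / k.factorial) • (F.mulVecLin ^ k) x := by
  have := exp_smul_mulVec_eq_of_hasDerivAt F
    (fun t => ∑ k ∈ Finset.range (N + 1), (t ^ k / k.factorial) • (F.mulVecLin ^ k) x)
    (fun t => ?_) s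
  · convert this
    rw [Finset.sum_range_succ']
    simp
  · have h1 : F *ᵥ (∑ k ∈ Finset.range (N + 1), (t ^ k / k.factorial) • (F.mulVecLin ^ k) x) =
        ∑ k ∈ Finset.range (N + 1), ((k * t ^ (k - 1)) / k.factorial) • (F.mulVecLin ^ k) x := by
      rw [← Matrix.mulVecLin_apply, map_sum, Finset.sum_range_succ, Finset.sum_range_succ' _ N,
        map_smul, ← Module.End.mul_apply, ← pow_succ', hx]
      simp only [smul_zero, add_zero, Nat.cast_zero, zero_mul, zero_div, zero_smul]
      refine Finset.sum_congr rfl fun k _ => ?_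
      rw [map_smul, ← Module.End.mul_apply, ← pow_succ', Nat.add_sub_cancel, Nat.factorial_succ]
      congr 1
      push_cast
      field_simp
    rw [h1]
    exact HasDerivAt.fun_sum fun k _ => ((hasDerivAt_pow k t).div_const _).smul_const _

/-- The matrix `A` acts on every irreducible subspace as the symmetric power of
`B ∈ SL(2, ℝ)`: it intertwines the Veronese maps. -/
def ActsThrough (E F H : Matrix (Fin d) (Fin d) ℝ) (B : SL(2, ℝ)) (A : GL (Fin d) ℝ) : Prop :=
  ∀ w N, IsHighestWeight E.mulVecLin F.mulVecLin H.mulVecLin w N → ∀ v : Fin 2 → ℝ,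
    A.val *ᵥ veronese F.mulVecLin w N (v 0) (v 1) =
      veronese F.mulVecLin w N ((B.val *ᵥ v) 0) ((B.val *ᵥ v) 1)

/-- The subgroup of `GL(d, ℝ)` generated by the one-parameter groups `exp (s E)` and
`exp (s F)`. -/
def expSubgroup (E F : Matrix (Fin d) (Fin d) ℝ) : Subgroup (GL (Fin d) ℝ) :=
  Subgroup.closure {A | ∃ s : ℝ, A.val = NormedSpace.exp (s • E) ∨ A.val = NormedSpace.exp (s • F)}

theorem exists_actsThrough (S : Sl2Relations E.mulVecLin F.mulVecLin H.mulVecLin)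
    {A : GL (Fin d) ℝ} (hA : A ∈ expSubgroup E F) : ∃ B, ActsThrough E F H B A := by
  induction hA using Subgroup.closure_induction with
  | mem A hA =>
    obtain ⟨s, hs | hs⟩ := hA
    · refine ⟨⟨!![1, s; 0, 1], by simp⟩, fun w N hw v => ?_⟩
      rw [hs, exp_e_mulVec_veronese S hw]
      simp [Matrix.mulVec, dotProduct, Fin.sum_univ_two]
    · refine ⟨⟨!![1, 0; s, 1], by simp⟩, fun w N hw v => ?_⟩
      rw [hs, exp_f_mulVec_veronese hw]
      simp [Matrix.mulVec, dotProduct, Fin.sum_univ_two, add_comm]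
  | one => exact ⟨1, fun w N hw v => by simp⟩
  | mul A A' _ _ h h' =>
    obtain ⟨B, hB⟩ := h
    obtain ⟨B', hB'⟩ := h'
    refine ⟨B * B', fun w N hw v => ?_⟩
    rw [Units.val_mul, ← Matrix.mulVec_mulVec, hB' w N hw, hB w N hw, Matrix.mulVec_mulVec]
    rfl
  | inv A _ h =>
    obtain ⟨B, hB⟩ := h
    refine ⟨B⁻¹, fun w N hw v => ?_⟩
    have h1 := hB w N hw (B⁻¹.val *ᵥ v)
    have h2 : B.val *ᵥ (B⁻¹.val *ᵥ v) = v := by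
      have : B.val * B⁻¹.val = 1 := by
        rw [← Matrix.SpecialLinearGroup.coe_mul, mul_inv_cancel, Matrix.SpecialLinearGroup.coe_one]
      rw [Matrix.mulVec_mulVec, this, Matrix.one_mulVec]
    rw [h2] at h1
    rw [← h1, Matrix.mulVec_mulVec, ← Units.val_mul, inv_mul_cancel, Units.val_one,
      Matrix.one_mulVec]

end Veronese

/-! ### Groups generated by a representation of `𝔰𝔩₂` -/

section Invariant

variable {d : ℕ}

/-- The elements of `S ⊆ PGL(d, ℝ)` are the classes of the products of matrices `exp (s E)` and
`exp (s F)`, where `E`, `F` and `H` satisfy the relations of `𝔰𝔩₂`. -/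
structure IsGeneratedBySl2 (S : Set PGL(d, ℝ)) (E F H : Matrix (Fin d) (Fin d) ℝ) : Prop where
  relations : Sl2Relations E.mulVecLin F.mulVecLin H.mulVecLin
  image_eq : Matrix.ProjGenLinGroup.mk '' (expSubgroup E F : Set (GL (Fin d) ℝ)) = S

open scoped Matrix.Norms.Operator in
theorem mulVec_mem_of_exp_mem {X : Matrix (Fin d) (Fin d) ℝ} {U : Submodule ℝ (Fin d → ℝ)}
    {x : Fin d → ℝ} (hx : ∀ s : ℝ, NormedSpace.exp (s • X) *ᵥ x ∈ U) : X *ᵥ x ∈ U := by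
  have h1 := hasDerivAt_matrix_mulVec (hasDerivAt_exp_smul_const' X (0 : ℝ))
    (hasDerivAt_const (0 : ℝ) x)
  simp only [zero_smul, NormedSpace.exp_zero, mul_one, Matrix.mulVec_zero, add_zero] at h1
  refine (Submodule.closed_of_finiteDimensional U).mem_of_tendsto h1.tendsto_slope_zero
    (Filter.Eventually.of_forall fun t => ?_)
  exact U.smul_mem _ (U.sub_mem (hx _) (hx _))

open scoped Matrix.Norms.Operator in
theorem exp_mulVec_mem {X : Matrix (Fin d) (Fin d) ℝ} {U : Submodule ℝ (Fin d → ℝ)}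
    (hX : ∀ x ∈ U, X *ᵥ x ∈ U) (s : ℝ) {x : Fin d → ℝ} (hx : x ∈ U) :
    NormedSpace.exp (s • X) *ᵥ x ∈ U := by
  let φ : Matrix (Fin d) (Fin d) ℝ →L[ℝ] (Fin d → ℝ) :=
    LinearMap.toContinuousLinearMap ((Matrix.mulVecBilin ℝ ℝ).flip x)
  have h1 := (NormedSpace.exp_series_hasSum_exp' (𝕂 := ℝ) (s • X)).mapL φ
  refine (Submodule.closed_of_finiteDimensional U).mem_of_tendsto h1
    (Filter.Eventually.of_forall fun t => ?_)
  have hpow : ∀ n : ℕ, X ^ n *ᵥ x ∈ U := by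
    intro n
    induction n with
    | zero => simpa using hx
    | succ n ih => rw [pow_succ', ← Matrix.mulVec_mulVec]; exact hX _ ih
  refine U.sum_mem fun n _ => ?_
  simp only [map_smul, smul_pow]
  exact U.smul_mem _ (U.smul_mem _ (hpow n))

namespace IsGeneratedBySl2

variable {S : Set PGL(d, ℝ)} {E F H : Matrix (Fin d) (Fin d) ℝ} (hS : IsGeneratedBySl2 S E F H)
include hS

theorem exists_mk_mem_e (s : ℝ) : ∃ A : GL (Fin d) ℝ, A.val = NormedSpace.exp (s • E) ∧
    Matrix.ProjGenLinGroup.mk A ∈ S := by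
  obtain ⟨A, hA⟩ := Matrix.isUnit_exp (s • E)
  exact ⟨A, hA, hS.image_eq ▸ ⟨A, Subgroup.subset_closure ⟨s, .inl hA⟩, rfl⟩⟩

theorem exists_mk_mem_f (s : ℝ) : ∃ A : GL (Fin d) ℝ, A.val = NormedSpace.exp (s • F) ∧
    Matrix.ProjGenLinGroup.mk A ∈ S := by
  obtain ⟨A, hA⟩ := Matrix.isUnit_exp (s • F)
  exact ⟨A, hA, hS.image_eq ▸ ⟨A, Subgroup.subset_closure ⟨s, .inr hA⟩, rfl⟩⟩

/-- A subspace is invariant under `S` if and only if it is invariant under `E` and `F`. -/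
theorem isInvariantSubspace_iff (U : Submodule ℝ (Fin d → ℝ)) :
    IsInvariantSubspace S U ↔ (∀ x ∈ U, E.mulVecLin x ∈ U) ∧ (∀ x ∈ U, F.mulVecLin x ∈ U) := by
  constructor
  · intro h
    refine ⟨fun x hx => mulVec_mem_of_exp_mem fun s => ?_,
      fun x hx => mulVec_mem_of_exp_mem fun s => ?_⟩
    · obtain ⟨A, hA, hAS⟩ := hS.exists_mk_mem_e s
      exact hA ▸ h A hAS x hx
    · obtain ⟨A, hA, hAS⟩ := hS.exists_mk_mem_f s
      exact hA ▸ h A hAS x hx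
  · rintro ⟨hE, hF⟩ A hA v hv
    rw [← hS.image_eq] at hA
    obtain ⟨A', hA', hAA'⟩ := hA
    obtain ⟨u, hu⟩ := Matrix.ProjGenLinGroup.mk_eq_mk_iff.1 hAA'
    have key : ∀ x ∈ U, A'.val *ᵥ x ∈ U ∧ A'⁻¹.val *ᵥ x ∈ U := by
      clear hAA' hu
      induction hA' using Subgroup.closure_induction with
      | mem A hA =>
        obtain ⟨s, hs | hs⟩ := hA <;> intro x hx
        · refine ⟨hs ▸ exp_mulVec_mem hE s hx, ?_⟩
          rw [Matrix.coe_units_inv, hs, ← Matrix.exp_neg, ← neg_smul]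
          exact exp_mulVec_mem hE _ hx
        · refine ⟨hs ▸ exp_mulVec_mem hF s hx, ?_⟩
          rw [Matrix.coe_units_inv, hs, ← Matrix.exp_neg, ← neg_smul]
          exact exp_mulVec_mem hF _ hx
      | one => simp
      | mul A B _ _ hA hB =>
        intro x hx
        rw [mul_inv_rev, Units.val_mul, Units.val_mul, ← Matrix.mulVec_mulVec,
          ← Matrix.mulVec_mulVec]
        exact ⟨(hA _ (hB x hx).1).1, (hB _ (hA x hx).2).2⟩
      | inv A _ hA =>
        intro x hx
        rw [inv_inv]
        exact (hA x hx).symm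
    have h2 : A.val *ᵥ v = u.val • (A'.val *ᵥ v) := by
      rw [← hu]
      simp [← Matrix.mulVec_mulVec, Matrix.GeneralLinearGroup.coe_scalar, Matrix.mulVec_smul]
    rw [h2]
    exact U.smul_mem _ (key v hv).1

/-- An irreducible subspace of dimension `n` is spanned by the vectors `F ^ k w`, `k < n`, for a
highest weight vector `w` of weight `n - 1`. -/
theorem exists_isHighestWeight_of_irreducible {V : Submodule ℝ (Fin d → ℝ)}
    (hV : IsIrreducibleSubspace S V) :
    ∃ w N, IsHighestWeight E.mulVecLin F.mulVecLin H.mulVecLin w N ∧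
      Module.finrank ℝ V = N + 1 ∧
      Submodule.span ℝ (Set.range fun k : Fin (N + 1) => (F.mulVecLin ^ (k : ℕ)) w) = V := by
  obtain ⟨hE, hF⟩ := (hS.isInvariantSubspace_iff V).1 hV.2.1
  have hH : ∀ x ∈ V, H.mulVecLin x ∈ V := by
    intro x hx
    rw [← add_sub_cancel_left (F.mulVecLin (E.mulVecLin x)) (H.mulVecLin x),
      ← hS.relations.e_f]
    exact V.sub_mem (hE _ (hF _ hx)) (hF _ (hE _ hx))
  obtain ⟨w, hwV, N, hw⟩ := hS.relations.exists_isHighestWeight hV.1 hE hH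
  have hspan := hw.span_eq hS.relations hwV hF fun U hU hUE hUF =>
    hV.2.2 U hU ((hS.isInvariantSubspace_iff U).2 ⟨hUE, hUF⟩)
  exact ⟨w, N, hw, hw.finrank_eq hS.relations hspan, hspan⟩

end IsGeneratedBySl2
end Invariant
/-! ### Invariant properly convex domains -/

section Cone

variable {d : ℕ}

theorem smul_mem_cone {Ω : Set (ℙ ℝ (Fin d → ℝ))} {v : Fin d → ℝ} (hv : v ∈ cone Ω) {c : ℝ}
    (hc : c ≠ 0) : c • v ∈ cone Ω := by
  obtain ⟨h0, hΩ⟩ := hv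
  refine ⟨smul_ne_zero hc h0, ?_⟩
  rwa [(Projectivization.mk_eq_mk_iff' ℝ _ _ (smul_ne_zero hc h0) h0).2 ⟨c, rfl⟩]

theorem mulVec_mem_cone {Ω : Set (ℙ ℝ (Fin d → ℝ))} {A : GL (Fin d) ℝ}
    (hA : (fun p : ℙ ℝ (Fin d → ℝ) => Matrix.ProjGenLinGroup.mk A • p) '' Ω = Ω)
    {v : Fin d → ℝ} (hv : v ∈ cone Ω) : A.val *ᵥ v ∈ cone Ω := by
  obtain ⟨h0, hΩ⟩ := hv
  have h1 : Matrix.ProjGenLinGroup.mk A • Projectivization.mk ℝ v h0 ∈ Ω := by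
    rw [← hA]
    exact ⟨_, hΩ, rfl⟩
  rw [Projectivization.PGL.mk_smul_mk] at h1
  exact ⟨_, h1⟩

end Cone

section OddWeight

variable {d : ℕ} {S : Set PGL(d, ℝ)} {E F H : Matrix (Fin d) (Fin d) ℝ}

/-- If `F ^ N ≠ 0 = F ^ (N + 1)` for an odd `N`, there is no invariant properly convex domain: for
a generic vector `x` of the cone over such a domain, the limits of
`|s| ^ (-N) • exp (s F) x` for `s → ∞` and for `s → -∞` are opposite nonzero vectors. -/
theorem IsGeneratedBySl2.not_preservesProperlyConvexDomain (hS : IsGeneratedBySl2 S E F H) {N : ℕ}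
    (hN : Odd N) (hF0 : ∀ x, (F.mulVecLin ^ (N + 1)) x = 0) (hF : F.mulVecLin ^ N ≠ 0) :
    ¬ PreservesProperlyConvexDomain S := by
  rintro ⟨Ω, ⟨⟨p0, hp0⟩, hopen, f, -, hf0, -, hbdd⟩, hinv⟩
  have hfc : Continuous f := f.continuous_of_finiteDimensional
  obtain ⟨R, hR⟩ := hbdd.exists_norm_le
  -- the half of the cone on which `f` is positive
  let C : Set (Fin d → ℝ) := {v | v ∈ cone Ω ∧ 0 < f v}
  have hCopen : IsOpen C := hopen.inter (isOpen_lt continuous_const hfc)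
  have hCR : ∀ v ∈ C, ‖v‖ ≤ R * f v := by
    rintro v ⟨hv, hfv⟩
    have := hR ((f v)⁻¹ • v) ⟨by simp [hfv.ne'], smul_mem_cone hv (inv_ne_zero hfv.ne')⟩
    rw [norm_smul, norm_inv, Real.norm_of_nonneg hfv.le, inv_mul_le_iff₀ hfv] at this
    linarith
  have hCsmul : ∀ v ∈ C, ∀ c : ℝ, 0 < c → c • v ∈ C := by
    rintro v ⟨hv, hfv⟩ c hc
    exact ⟨smul_mem_cone hv hc.ne', by rw [map_smul]; exact mul_pos hc hfv⟩
  have hcone : ∀ v ∈ cone Ω, ∀ s : ℝ, NormedSpace.exp (s • F) *ᵥ v ∈ cone Ω := by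
    intro v hv s
    obtain ⟨A, hA, hAS⟩ := hS.exists_mk_mem_f s
    exact hA ▸ mulVec_mem_cone (hinv _ hAS) hv
  have hCexp : ∀ v ∈ C, ∀ s : ℝ, NormedSpace.exp (s • F) *ᵥ v ∈ C := by
    rintro v ⟨hv, hfv⟩ s
    refine ⟨hcone v hv s, ?_⟩
    have hc : Continuous fun s : ℝ => f (NormedSpace.exp (s • F) *ᵥ v) := by
      refine hfc.comp ?_
      simp_rw [exp_smul_mulVec_eq_sum (hF0 v)]
      fun_prop
    by_contra hneg
    obtain ⟨t, ht⟩ := mem_range_of_exists_le_of_exists_ge hc ⟨s, not_lt.1 hneg⟩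
      ⟨0, by simpa using hfv.le⟩
    exact hf0 _ (hcone v hv t) ht
  obtain ⟨x, hxC, hx⟩ : ∃ x ∈ C, (F.mulVecLin ^ N) x ≠ 0 := by
    obtain ⟨y, hyC⟩ : ∃ y, y ∈ C := by
      induction p0 using Projectivization.ind with
      | h v hv =>
        have hvΩ : v ∈ cone Ω := ⟨hv, hp0⟩
        rcases lt_or_gt_of_ne (hf0 v hvΩ) with h | h
        · exact ⟨-v, by simpa using smul_mem_cone hvΩ (c := -1) (by norm_num), by simpa using h⟩
        · exact ⟨v, hvΩ, h⟩
    obtain ⟨z, hz⟩ : ∃ z, (F.mulVecLin ^ N) z ≠ 0 := by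
      by_contra! h
      exact hF (LinearMap.ext h)
    by_cases hy : (F.mulVecLin ^ N) y = 0
    · have hc : Continuous fun t : ℝ => y + t • z := by fun_prop
      have h1 : ∀ᶠ t : ℝ in nhdsWithin 0 {0}ᶜ, y + t • z ∈ C :=
        nhdsWithin_le_nhds ((hCopen.preimage hc).mem_nhds (by simpa using hyC))
      obtain ⟨t, ht, ht0⟩ := (h1.and self_mem_nhdsWithin).exists
      exact ⟨_, ht, by simpa [hy, hz] using ht0⟩
    · exact ⟨y, hyC, hy⟩
  let p : ℝ → Fin d → ℝ := fun r =>
    ∑ k ∈ Finset.range (N + 1), (r ^ (N - k) / k.factorial) • (F.mulVecLin ^ k) x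
  have hpc : Continuous p := by fun_prop
  have hp0' : p 0 ≠ 0 := by
    have : p 0 = (1 / (N.factorial : ℝ)) • (F.mulVecLin ^ N) x := by
      simp only [p]
      rw [Finset.sum_range_succ, Finset.sum_eq_zero]
      · simp
      · intro k hk
        have := Finset.mem_range.1 hk
        simp [show N - k ≠ 0 by omega]
    rw [this]
    exact smul_ne_zero (by positivity) hx
  have hpr : ∀ r : ℝ, r ≠ 0 → p r = r ^ N • (NormedSpace.exp (r⁻¹ • F) *ᵥ x) := by
    intro r hr
    rw [exp_smul_mulVec_eq_sum (hF0 x), Finset.smul_sum]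
    refine Finset.sum_congr rfl fun k hk => ?_
    have hk' : k ≤ N := Nat.lt_succ_iff.1 (Finset.mem_range.1 hk)
    rw [smul_smul]
    congr 1
    rw [pow_sub₀ _ hr hk', inv_pow]
    ring
  have hpos : ‖p 0‖ ≤ R * f (p 0) := by
    have h1 : ∀ᶠ r : ℝ in nhdsWithin 0 (Set.Ioi 0), ‖p r‖ ≤ R * f (p r) := by
      filter_upwards [self_mem_nhdsWithin] with r hr
      rw [hpr r (ne_of_gt hr)]
      exact hCR _ (hCsmul _ (hCexp x hxC _) _ (pow_pos hr N))
    exact le_of_tendsto_of_tendsto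
      ((hpc.norm.tendsto 0).mono_left nhdsWithin_le_nhds)
      (((continuous_const.mul (hfc.comp hpc)).tendsto 0).mono_left nhdsWithin_le_nhds) h1
  have hneg : ‖p 0‖ ≤ R * -f (p 0) := by
    have h1 : ∀ᶠ r : ℝ in nhdsWithin 0 (Set.Iio 0), ‖p r‖ ≤ R * -f (p r) := by
      filter_upwards [self_mem_nhdsWithin] with r hr
      have h2 := hCR _ (hCsmul _ (hCexp x hxC r⁻¹) (-r ^ N) (neg_pos.2 (hN.pow_neg hr)))
      rwa [neg_smul, ← hpr r (ne_of_lt hr), norm_neg, map_neg] at h2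
    exact le_of_tendsto_of_tendsto
      ((hpc.norm.tendsto 0).mono_left nhdsWithin_le_nhds)
      (((continuous_const.mul (hfc.comp hpc).neg).tendsto 0).mono_left nhdsWithin_le_nhds) h1
  have : 0 < ‖p 0‖ := norm_pos_iff.2 hp0'
  linarith

end OddWeight

section EvenWeight

variable {d : ℕ} {S : Set PGL(d, ℝ)} {E F H : Matrix (Fin d) (Fin d) ℝ}

/-- The squared Hilbert–Schmidt norm of a matrix in `SL(2, ℝ)`. -/
def normSq (B : SL(2, ℝ)) : ℝ := B 0 0 ^ 2 + B 0 1 ^ 2 + B 1 0 ^ 2 + B 1 1 ^ 2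

theorem two_le_normSq (B : SL(2, ℝ)) : 2 ≤ normSq B := by
  have := B.det_coe
  rw [Matrix.det_fin_two] at this
  rw [normSq]
  nlinarith [sq_nonneg (B 0 0 - B 1 1), sq_nonneg (B 0 1 + B 1 0)]

theorem add_pow_le_two_pow_mul {a b : ℝ} (ha : 0 ≤ a) (hb : 0 ≤ b) (p : ℕ) :
    (a + b) ^ p ≤ 2 ^ p * (a ^ p + b ^ p) := by
  have h1 : a + b ≤ 2 * max a b := by linarith [le_max_left a b, le_max_right a b]
  have h2 : max a b ^ p ≤ a ^ p + b ^ p := by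
    rcases max_choice a b with h | h <;> rw [h]
    · linarith [pow_nonneg hb p]
    · linarith [pow_nonneg ha p]
  calc (a + b) ^ p ≤ (2 * max a b) ^ p := pow_le_pow_left₀ (by positivity) h1 p
    _ = 2 ^ p * max a b ^ p := mul_pow ..
    _ ≤ _ := by gcongr

theorem normSq_pow_le (B : SL(2, ℝ)) (p : ℕ) :
    normSq B ^ p ≤ 4 ^ p *
      (B 0 0 ^ (2 * p) + B 1 0 ^ (2 * p) + (B 0 1 ^ (2 * p) + B 1 1 ^ (2 * p))) := by
  have h0 : normSq B = (B 0 0 ^ 2 + B 1 0 ^ 2) + (B 0 1 ^ 2 + B 1 1 ^ 2) := by rw [normSq]; ring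
  have h1 := add_pow_le_two_pow_mul (sq_nonneg (B 0 0)) (sq_nonneg (B 1 0)) p
  have h2 := add_pow_le_two_pow_mul (sq_nonneg (B 0 1)) (sq_nonneg (B 1 1)) p
  have h3 := add_pow_le_two_pow_mul (a := B 0 0 ^ 2 + B 1 0 ^ 2) (b := B 0 1 ^ 2 + B 1 1 ^ 2)
    (by positivity) (by positivity) p
  simp only [← pow_mul] at h1 h2
  rw [h0]
  calc _ ≤ _ := h3
    _ ≤ 2 ^ p * (2 ^ p * (B 0 0 ^ (2 * p) + B 1 0 ^ (2 * p)) +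
        2 ^ p * (B 0 1 ^ (2 * p) + B 1 1 ^ (2 * p))) := by gcongr
    _ = _ := by rw [show (4 : ℝ) = 2 * 2 by norm_num, mul_pow]; ring

theorem norm_veronese_le {W : Type*} [NormedAddCommGroup W] [NormedSpace ℝ W]
    (f : Module.End ℝ W) (w : W) (N : ℕ) : ∃ C, 0 ≤ C ∧ ∀ x y D : ℝ, ∀ p : ℕ, N ≤ 2 * p → 1 ≤ D →
      x ^ 2 + y ^ 2 ≤ D → ‖veronese f w N x y‖ ≤ C * D ^ p := by
  refine ⟨∑ k ∈ Finset.range (N + 1), ‖(f ^ k) w‖, Finset.sum_nonneg fun _ _ => norm_nonneg _,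
    fun x y D p hN hD hxy => ?_⟩
  rw [veronese, Finset.sum_mul]
  refine norm_sum_le_of_le _ fun k hk => ?_
  have hk' : k ≤ N := Nat.lt_succ_iff.1 (Finset.mem_range.1 hk)
  have hx : |x| ≤ √D := Real.abs_le_sqrt (by nlinarith [sq_nonneg y])
  have hy : |y| ≤ √D := Real.abs_le_sqrt (by nlinarith [sq_nonneg x])
  have h1 : |x| ^ (N - k) * |y| ^ k ≤ D ^ p :=
    calc |x| ^ (N - k) * |y| ^ k ≤ √D ^ (N - k) * √D ^ k := by gcongr
      _ = √D ^ N := by rw [← pow_add, Nat.sub_add_cancel hk']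
      _ ≤ √D ^ (2 * p) := pow_le_pow_right₀ (Real.one_le_sqrt.2 hD) hN
      _ = D ^ p := by rw [pow_mul, Real.sq_sqrt (by linarith)]
  rw [norm_smul, norm_div, norm_mul, norm_pow, norm_pow, Real.norm_eq_abs, Real.norm_eq_abs,
    mul_comm]
  refine mul_le_mul_of_nonneg_left (le_trans (div_le_self (by positivity) ?_) h1) (norm_nonneg _)
  rw [Real.norm_natCast]
  exact_mod_cast Nat.one_le_iff_ne_zero.2 k.factorial_ne_zero

/-- The image of the Veronese map spans the irreducible subspace: its span is invariant under
`F`. -/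
theorem IsHighestWeight.f_pow_mem_span_veronese {w : Fin d → ℝ} {N : ℕ}
    (hw : IsHighestWeight E.mulVecLin F.mulVecLin H.mulVecLin w N) (k : ℕ) :
    (F.mulVecLin ^ k) w ∈ Submodule.span ℝ
      (Set.range fun v : Fin 2 → ℝ => veronese F.mulVecLin w N (v 0) (v 1)) := by
  set Q := Submodule.span ℝ
    (Set.range fun v : Fin 2 → ℝ => veronese F.mulVecLin w N (v 0) (v 1)) with hQ
  have hmem : ∀ x y, veronese F.mulVecLin w N x y ∈ Q := fun x y =>
    Submodule.subset_span ⟨![x, y], by simp⟩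
  have hQF : ∀ x ∈ Q, F *ᵥ x ∈ Q := by
    intro x hx
    induction hx using Submodule.span_induction with
    | mem x hx =>
      obtain ⟨v, rfl⟩ := hx
      refine mulVec_mem_of_exp_mem fun s => ?_
      simp only [exp_f_mulVec_veronese hw]
      exact hmem _ _
    | zero => simp
    | add x y _ _ hx hy => rw [Matrix.mulVec_add]; exact Q.add_mem hx hy
    | smul c x _ hx => rw [Matrix.mulVec_smul]; exact Q.smul_mem _ hx
  induction k with
  | zero =>
    have h1 : veronese F.mulVecLin w N 1 0 = w := by
      rw [veronese, Finset.sum_range_succ']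
      simp
    have h2 := hmem 1 0
    rwa [h1] at h2
  | succ k ih => rw [pow_succ', Module.End.mul_apply]; exact hQF _ ih

theorem exists_norm_mulVec_veronese_le {N p : ℕ} {w : Fin d → ℝ}
    (hw : IsHighestWeight E.mulVecLin F.mulVecLin H.mulVecLin w N) (hN : N ≤ 2 * p)
    (v : Fin 2 → ℝ) : ∃ C, 0 ≤ C ∧ ∀ A B, ActsThrough E F H B A →
      ‖A.val *ᵥ veronese F.mulVecLin w N (v 0) (v 1)‖ ≤ C * normSq B ^ p := by
  obtain ⟨C, hC, h⟩ := norm_veronese_le F.mulVecLin w N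
  refine ⟨C * (1 + v 0 ^ 2 + v 1 ^ 2) ^ p, by positivity, fun A B hAB => ?_⟩
  rw [hAB w N hw, mul_assoc, ← mul_pow]
  have h2 := two_le_normSq B
  have h3 : 1 ≤ 1 + v 0 ^ 2 + v 1 ^ 2 := by nlinarith [sq_nonneg (v 0), sq_nonneg (v 1)]
  refine h _ _ _ p hN (by nlinarith) ?_
  simp only [Matrix.mulVec, dotProduct, Fin.sum_univ_two]
  rw [normSq]
  -- Cauchy–Schwarz for both rows of `B`
  nlinarith [sq_nonneg (B 0 0 * v 1 - B 0 1 * v 0), sq_nonneg (B 1 0 * v 1 - B 1 1 * v 0),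
    sq_nonneg (B 0 0), sq_nonneg (B 0 1), sq_nonneg (B 1 0), sq_nonneg (B 1 1)]

/-- If all highest weights are at most `2 p`, the group acts with norm at most a multiple of
`normSq B ^ p`. -/
theorem exists_norm_mulVec_le {ι : Type*} {V : ι → Submodule ℝ (Fin d → ℝ)} (hV : iSup V = ⊤)
    {p : ℕ} (hVw : ∀ j, ∃ w N, N ≤ 2 * p ∧
      IsHighestWeight E.mulVecLin F.mulVecLin H.mulVecLin w N ∧
      Submodule.span ℝ (Set.range fun k : Fin (N + 1) => (F.mulVecLin ^ (k : ℕ)) w) = V j) :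
    ∃ C, 0 ≤ C ∧ ∀ A B, ActsThrough E F H B A → ∀ x,
      ‖A.val *ᵥ x‖ ≤ C * normSq B ^ p * ‖x‖ := by
  -- the vectors satisfying a bound form a subspace
  let T : Submodule ℝ (Fin d → ℝ) :=
    { carrier := {x | ∃ C, 0 ≤ C ∧ ∀ A B, ActsThrough E F H B A →
        ‖A.val *ᵥ x‖ ≤ C * normSq B ^ p}
      zero_mem' := ⟨0, le_rfl, fun A B _ => by simp⟩
      add_mem' := by
        rintro x y ⟨C, hC, hx⟩ ⟨D, hD, hy⟩
        refine ⟨C + D, by positivity, fun A B hAB => ?_⟩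
        rw [Matrix.mulVec_add, add_mul]
        exact (norm_add_le _ _).trans (add_le_add (hx A B hAB) (hy A B hAB))
      smul_mem' := by
        rintro c x ⟨C, hC, hx⟩
        refine ⟨|c| * C, by positivity, fun A B hAB => ?_⟩
        rw [Matrix.mulVec_smul, norm_smul, mul_assoc, Real.norm_eq_abs]
        exact mul_le_mul_of_nonneg_left (hx A B hAB) (abs_nonneg c) }
  have hT : T = ⊤ := by
    rw [eq_top_iff, ← hV]
    refine iSup_le fun j => ?_
    obtain ⟨w, N, hN, hw, hspan⟩ := hVw j
    rw [← hspan, Submodule.span_le]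
    rintro _ ⟨k, rfl⟩
    refine (Submodule.span_le (p := T)).2 ?_ (hw.f_pow_mem_span_veronese k)
    rintro _ ⟨v, rfl⟩
    exact exists_norm_mulVec_veronese_le hw hN v
  have hall : ∀ i : Fin d, ∃ C, 0 ≤ C ∧ ∀ A B, ActsThrough E F H B A →
      ‖A.val *ᵥ Pi.single i (1 : ℝ)‖ ≤ C * normSq B ^ p := fun i => by
    have : (Pi.single i (1 : ℝ) : Fin d → ℝ) ∈ T := hT ▸ Submodule.mem_top
    exact this
  choose C hC hCb using hall
  refine ⟨∑ i, C i, Finset.sum_nonneg fun i _ => hC i, fun A B hAB x => ?_⟩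
  have hx : x = ∑ i, x i • (Pi.single i (1 : ℝ) : Fin d → ℝ) := by
    ext j
    simp [Finset.sum_apply, Pi.single_apply]
  have h1 : A.val *ᵥ x = ∑ i, x i • (A.val *ᵥ Pi.single i (1 : ℝ)) := by
    conv_lhs => rw [hx]
    simp only [Matrix.mulVec_sum, Matrix.mulVec_smul]
  rw [h1, Finset.sum_mul, Finset.sum_mul]
  refine norm_sum_le_of_le _ fun i _ => ?_
  rw [norm_smul, mul_comm]
  exact mul_le_mul (hCb i A B hAB) (norm_le_pi_norm x i) (norm_nonneg _)
    (mul_nonneg (hC i) (pow_nonneg (by linarith [two_le_normSq B]) p))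

/-- A linear form that restricts to `x ^ N + y ^ N` on the image of the Veronese map. -/
theorem IsHighestWeight.exists_linearForm (R : Sl2Relations E.mulVecLin F.mulVecLin H.mulVecLin)
    {w : Fin d → ℝ} {N : ℕ} (hw : IsHighestWeight E.mulVecLin F.mulVecLin H.mulVecLin w N) :
    ∃ f : (Fin d → ℝ) →ₗ[ℝ] ℝ, ∀ x y, f (veronese F.mulVecLin w N x y) = x ^ N + y ^ N := by
  let c : Fin (N + 1) → ℝ := fun k =>
    (if (k : ℕ) = 0 then 1 else 0) + (if (k : ℕ) = N then (N.factorial : ℝ) else 0)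
  let b := Module.Basis.span (hw.linearIndependent R)
  obtain ⟨f, hf⟩ := (b.constr ℝ c).exists_extend
  have hfk : ∀ k : Fin (N + 1), f ((F.mulVecLin ^ (k : ℕ)) w) = c k := by
    intro k
    have h1 := LinearMap.congr_fun hf (b k)
    rw [b.constr_basis, LinearMap.comp_apply, Submodule.subtype_apply,
      Module.Basis.span_apply] at h1
    exact h1
  refine ⟨f, fun x y => ?_⟩
  rw [veronese, map_sum, Finset.sum_range]
  simp only [map_smul, hfk, c, smul_eq_mul, mul_add, Finset.sum_add_distrib]
  congr 1
  · rw [Finset.sum_eq_single 0]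
    · simp
    · intro k _ hk
      have : (k : ℕ) ≠ 0 := fun h => hk (Fin.ext h)
      simp [this]
    · simp
  · rw [Finset.sum_eq_single (Fin.last N)]
    · have : (N.factorial : ℝ) ≠ 0 := by positivity
      simp [this]
    · intro k _ hk
      have : (k : ℕ) ≠ N := fun h => hk (Fin.ext h)
      simp [this]
    · simp

/-- If the largest highest weight is `2 p`, there is an invariant properly convex domain: with
`f` equal to `x ^ (2 p) + y ^ (2 p)` on the Veronese cone of the largest weight, it consists of the
lines through the interior of the set of `v` with `‖A v‖ ≤ R f (A v)` for all `A` in the group. -/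
theorem IsGeneratedBySl2.preservesProperlyConvexDomain (hS : IsGeneratedBySl2 S E F H) {p : ℕ}
    {w : Fin d → ℝ} (hw : IsHighestWeight E.mulVecLin F.mulVecLin H.mulVecLin w (2 * p)) {C : ℝ}
    (hC : 0 ≤ C) (hCb : ∀ A B, ActsThrough E F H B A → ∀ x,
      ‖A.val *ᵥ x‖ ≤ C * normSq B ^ p * ‖x‖) :
    PreservesProperlyConvexDomain S := by
  obtain ⟨f, hf⟩ := hw.exists_linearForm hS.relations
  have hfc : Continuous f := f.continuous_of_finiteDimensional
  obtain ⟨K, hK, hKf⟩ : ∃ K : ℝ, 0 ≤ K ∧ ∀ x, |f x| ≤ K * ‖x‖ :=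
    ⟨_, norm_nonneg (LinearMap.toContinuousLinearMap f),
      (LinearMap.toContinuousLinearMap f).le_opNorm⟩
  set x₀ := veronese F.mulVecLin w (2 * p) 1 0 + veronese F.mulVecLin w (2 * p) 0 1 with hx₀
  have hfx₀ : ∀ A B, ActsThrough E F H B A → normSq B ^ p ≤ 4 ^ p * f (A.val *ᵥ x₀) := by
    intro A B hAB
    have h1 := hAB w _ hw ![1, 0]
    have h2 := hAB w _ hw ![0, 1]
    simp only [Matrix.cons_val_zero, Matrix.cons_val_one] at h1 h2
    rw [hx₀, Matrix.mulVec_add, h1, h2, map_add, hf, hf]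
    simpa [Matrix.mulVec, dotProduct, Fin.sum_univ_two] using normSq_pow_le B p
  -- a radius for which the orbit of the ball around `x₀` stays in the half-space `0 < f`
  set ε : ℝ := (2 * 4 ^ p * (K * C + 1))⁻¹ with hε
  have hε0 : 0 < ε := by positivity
  have hεK : 4 ^ p * (K * C * ε) ≤ 1 / 2 := by
    rw [hε]
    have : (0 : ℝ) < 4 ^ p := by positivity
    have h1 : 0 ≤ K * C := by positivity
    rw [show (4 : ℝ) ^ p * (K * C * (2 * 4 ^ p * (K * C + 1))⁻¹) = 1 / 2 * (K * C / (K * C + 1)) by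
      field_simp]
    have h2 : K * C / (K * C + 1) ≤ 1 := (div_le_one (by positivity)).2 (by linarith)
    linarith
  set R : ℝ := 2 * 4 ^ p * (C * (‖x₀‖ + ε)) with hR
  have hball : ∀ A B, ActsThrough E F H B A → ∀ x ∈ Metric.ball x₀ ε,
      ‖A.val *ᵥ x‖ ≤ R * f (A.val *ᵥ x) := by
    intro A B hAB x hx
    have hm : 0 ≤ normSq B ^ p := pow_nonneg (by linarith [two_le_normSq B]) p
    have hxε : ‖x - x₀‖ ≤ ε := (mem_ball_iff_norm.1 hx).le
    have h1 : f (A.val *ᵥ x) = f (A.val *ᵥ x₀) + f (A.val *ᵥ (x - x₀)) := by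
      rw [← map_add, ← Matrix.mulVec_add, add_sub_cancel]
    have h2 : |f (A.val *ᵥ (x - x₀))| ≤ K * (C * normSq B ^ p * ε) :=
      (hKf _).trans (mul_le_mul_of_nonneg_left ((hCb A B hAB _).trans (by gcongr)) hK)
    have h3 : normSq B ^ p ≤ 2 * 4 ^ p * f (A.val *ᵥ x) := by
      have h4 := hfx₀ A B hAB
      have h5 := neg_abs_le (f (A.val *ᵥ (x - x₀)))
      have h6 : (4 : ℝ) ^ p * |f (A.val *ᵥ (x - x₀))| ≤ 1 / 2 * normSq B ^ p :=
        calc (4 : ℝ) ^ p * |f (A.val *ᵥ (x - x₀))| ≤ 4 ^ p * (K * (C * normSq B ^ p * ε)) := by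
              gcongr
          _ = 4 ^ p * (K * C * ε) * normSq B ^ p := by ring
          _ ≤ _ := by gcongr
      have h7 : (0 : ℝ) < 4 ^ p := by positivity
      rw [h1]
      nlinarith
    have h8 : ‖x‖ ≤ ‖x₀‖ + ε := by
      have := norm_add_le x₀ (x - x₀)
      rw [add_sub_cancel] at this
      linarith
    calc ‖A.val *ᵥ x‖ ≤ C * normSq B ^ p * ‖x‖ := hCb A B hAB x
      _ ≤ C * normSq B ^ p * (‖x₀‖ + ε) := by gcongr
      _ = C * (‖x₀‖ + ε) * normSq B ^ p := by ring
      _ ≤ C * (‖x₀‖ + ε) * (2 * 4 ^ p * f (A.val *ᵥ x)) := by gcongr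
      _ = R * f (A.val *ᵥ x) := by rw [hR]; ring
  let D : Set (Fin d → ℝ) := {v | ∀ A ∈ expSubgroup E F, ‖A.val *ᵥ v‖ ≤ R * f (A.val *ᵥ v)}
  have hD1 : ∀ v ∈ D, ‖v‖ ≤ R * f v := fun v hv => by simpa using hv 1 (one_mem _)
  have hR0 : 0 ≤ R := by positivity
  have hDpos : ∀ v ∈ D, v ≠ 0 → 0 < f v := by
    intro v hv h0
    have h1 := norm_pos_iff.2 h0
    have h2 := hD1 v hv
    by_contra h3
    nlinarith
  have hDA : ∀ A ∈ expSubgroup E F, ∀ v ∈ D, A.val *ᵥ v ∈ D := by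
    intro A hA v hv A' hA'
    have := hv (A' * A) (mul_mem hA' hA)
    rwa [Units.val_mul, ← Matrix.mulVec_mulVec] at this
  have hDsmul : ∀ c : ℝ, 0 < c → ∀ v ∈ D, c • v ∈ D := by
    intro c hc v hv A hA
    rw [Matrix.mulVec_smul, map_smul, norm_smul, Real.norm_of_nonneg hc.le, smul_eq_mul,
      mul_left_comm]
    exact mul_le_mul_of_nonneg_left (hv A hA) hc.le
  have hDconv : Convex ℝ D := by
    intro u hu v hv a b ha hb _ A hA
    rw [Matrix.mulVec_add, Matrix.mulVec_smul, Matrix.mulVec_smul, map_add, map_smul, map_smul]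
    refine (norm_add_le _ _).trans ?_
    rw [norm_smul, norm_smul, Real.norm_of_nonneg ha, Real.norm_of_nonneg hb, smul_eq_mul,
      smul_eq_mul]
    have h1 := mul_le_mul_of_nonneg_left (hu A hA) ha
    have h2 := mul_le_mul_of_nonneg_left (hv A hA) hb
    linarith
  have hballD : Metric.ball x₀ ε ⊆ D := by
    intro x hx A hA
    obtain ⟨B, hB⟩ := exists_actsThrough hS.relations hA
    exact hball A B hB x hx
  have hx₀0 : x₀ ≠ 0 := by
    intro h0
    have h1 : f x₀ = 2 ∨ f x₀ = 4 := by
      rw [hx₀, map_add, hf, hf]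
      rcases Nat.eq_zero_or_pos p with rfl | h
      · norm_num
      · simp [h.ne']; norm_num
    rw [h0, map_zero] at h1
    norm_num at h1
  have hDint : ∀ v ∈ interior D, v ≠ 0 := by
    rintro v hv rfl
    have hc : Continuous fun t : ℝ => t • x₀ := by fun_prop
    have hc' : Continuous fun t : ℝ => -(t • x₀) := by fun_prop
    have h1 : ∀ᶠ t : ℝ in nhdsWithin 0 {0}ᶜ, t • x₀ ∈ interior D :=
      nhdsWithin_le_nhds ((isOpen_interior.preimage hc).mem_nhds (by simpa using hv))
    have h1' : ∀ᶠ t : ℝ in nhdsWithin 0 {0}ᶜ, -(t • x₀) ∈ interior D :=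
      nhdsWithin_le_nhds ((isOpen_interior.preimage hc').mem_nhds (by simpa using hv))
    obtain ⟨t, ⟨ht1, ht2⟩, ht0⟩ := ((h1.and h1').and self_mem_nhdsWithin).exists
    have h2 : t • x₀ ≠ 0 := smul_ne_zero ht0 hx₀0
    have h3 := hDpos _ (interior_subset ht1) h2
    have h4 := hDpos _ (interior_subset ht2) (neg_ne_zero.2 h2)
    rw [map_neg] at h4
    linarith
  have hintA : ∀ A ∈ expSubgroup E F, ∀ v ∈ interior D, A.val *ᵥ v ∈ interior D := by
    intro A hA v hv
    have hc : Continuous fun u : Fin d → ℝ => A⁻¹.val *ᵥ u := by fun_prop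
    have hAA : ∀ u : Fin d → ℝ, A.val *ᵥ (A⁻¹.val *ᵥ u) = u := fun u => by
      rw [Matrix.mulVec_mulVec, ← Units.val_mul, mul_inv_cancel, Units.val_one, Matrix.one_mulVec]
    have hAA' : A⁻¹.val *ᵥ (A.val *ᵥ v) = v := by
      rw [Matrix.mulVec_mulVec, ← Units.val_mul, inv_mul_cancel, Units.val_one, Matrix.one_mulVec]
    refine interior_maximal ?_ ((isOpen_interior (s := D)).preimage hc) (a := A.val *ᵥ v) ?_
    · intro u hu
      rw [← hAA u]
      exact hDA A hA _ (interior_subset hu)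
    · show A⁻¹.val *ᵥ (A.val *ᵥ v) ∈ interior D
      rwa [hAA']
  have hintsmul : ∀ c : ℝ, 0 < c → ∀ v ∈ interior D, c • v ∈ interior D := by
    intro c hc v hv
    have hcont : Continuous fun u : Fin d → ℝ => c⁻¹ • u := by fun_prop
    refine interior_maximal ?_ ((isOpen_interior (s := D)).preimage hcont) (a := c • v) ?_
    · intro u hu
      have := hDsmul c hc _ (interior_subset hu)
      rwa [smul_smul, mul_inv_cancel₀ hc.ne', one_smul] at this
    · simpa [smul_smul, inv_mul_cancel₀ hc.ne'] using hv
  let Ω : Set (ℙ ℝ (Fin d → ℝ)) := {q | ∃ v, ∃ hv : v ≠ 0, v ∈ interior D ∧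
    q = Projectivization.mk ℝ v hv}
  have hcone : ∀ v, v ∈ cone Ω ↔ v ∈ interior D ∨ -v ∈ interior D := by
    intro v
    constructor
    · rintro ⟨hv, u, hu, huD, huv⟩
      obtain ⟨c, hc⟩ := (Projectivization.mk_eq_mk_iff' ℝ _ _ hv hu).1 huv
      rcases lt_trichotomy c 0 with h | h | h
      · right
        rw [← hc, ← neg_smul]
        exact hintsmul _ (neg_pos.2 h) _ huD
      · rw [h, zero_smul] at hc
        exact absurd hc.symm hv
      · left
        rw [← hc]
        exact hintsmul _ h _ huD
    · rintro (h | h)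
      · exact ⟨hDint v h, v, hDint v h, h, rfl⟩
      · have h0 := neg_ne_zero.1 (hDint _ h)
        refine ⟨h0, -v, hDint _ h, h, ?_⟩
        rw [Projectivization.mk_eq_mk_iff']
        exact ⟨-1, by simp⟩
  have hslice : {v | f v = 1 ∧ v ∈ cone Ω} = {v | f v = 1} ∩ interior D := by
    ext v
    simp only [Set.mem_ofPred_eq, Set.mem_inter_iff, hcone]
    refine and_congr_right fun h1 => ⟨fun h => h.resolve_right fun h2 => ?_, Or.inl⟩
    have := hDpos _ (interior_subset h2) (hDint _ h2)
    rw [map_neg, h1] at this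
    linarith
  refine ⟨Ω, ⟨?_, ?_, f, ?_, ?_, ?_, ?_⟩, ?_⟩
  · exact ⟨_, x₀, hx₀0, interior_maximal hballD Metric.isOpen_ball (Metric.mem_ball_self hε0), rfl⟩
  · have : cone Ω = interior D ∪ (fun v => -v) ⁻¹' interior D := Set.ext hcone
    rw [this]
    exact isOpen_interior.union (isOpen_interior.preimage continuous_neg)
  · rintro rfl
    exact (hDpos x₀ (hballD (Metric.mem_ball_self hε0)) hx₀0).ne' rfl
  · intro v hv
    rcases (hcone v).1 hv with h | h
    · exact (hDpos _ (interior_subset h) (hDint _ h)).ne'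
    · have := (hDpos _ (interior_subset h) (hDint _ h)).ne'
      simpa using this
  · rw [hslice]
    refine Convex.inter ?_ hDconv.interior
    intro u hu v hv a b _ _ hab
    simp only [Set.mem_ofPred_eq] at hu hv ⊢
    rw [map_add, map_smul, map_smul, hu, hv]
    simpa using hab
  · rw [hslice]
    refine (isBounded_iff_forall_norm_le).2 ⟨R, fun v hv => ?_⟩
    have h1 := hD1 v (interior_subset hv.2)
    rwa [show f v = 1 from hv.1, mul_one] at h1
  · have hsub : ∀ A ∈ expSubgroup E F, ∀ q ∈ Ω, Matrix.ProjGenLinGroup.mk A • q ∈ Ω := by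
      rintro A hA _ ⟨v, hv, hvD, rfl⟩
      rw [Projectivization.PGL.mk_smul_mk]
      exact ⟨_, _, hintA A hA v hvD, rfl⟩
    intro g hg
    rw [← hS.image_eq] at hg
    obtain ⟨A, hA, rfl⟩ := hg
    refine Set.Subset.antisymm ?_ ?_
    · rintro _ ⟨q, hq, rfl⟩
      exact hsub A hA q hq
    · intro q hq
      refine ⟨Matrix.ProjGenLinGroup.mk A⁻¹ • q, hsub _ (inv_mem hA) q hq, ?_⟩
      simp only [map_inv, smul_inv_smul]

end EvenWeight

section Decomposition

variable {d : ℕ} {S : Set PGL(d, ℝ)} {E F H : Matrix (Fin d) (Fin d) ℝ}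

/-- The dimension criterion for a group generated by a representation of `𝔰𝔩₂`. -/
theorem IsGeneratedBySl2.preservesProperlyConvexDomain_iff (hS : IsGeneratedBySl2 S E F H)
    {m : ℕ} {V : Fin m → Submodule ℝ (Fin d → ℝ)} (hV : iSup V = ⊤)
    (hirr : ∀ j, IsIrreducibleSubspace S (V j)) :
    PreservesProperlyConvexDomain S ↔
      Odd (Finset.univ.sup fun j => Module.finrank ℝ (V j)) := by
  choose w N hw hN hspan using fun j => hS.exists_isHighestWeight_of_irreducible (hirr j)
  rcases isEmpty_or_nonempty (Fin m) with hm | hm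
  · -- here `d = 0`, and there are no domains since the projective space is empty
    have hsub : Subsingleton (Fin d → ℝ) := by
      rw [← Submodule.subsingleton_iff ℝ, ← subsingleton_iff_bot_eq_top, ← hV, iSup_of_empty]
    refine iff_of_false ?_ (by simp)
    rintro ⟨Ω, ⟨⟨q, -⟩, -⟩, -⟩
    induction q using Projectivization.ind with
    | h v hv => exact hv (Subsingleton.elim _ _)
  obtain ⟨j₀, -, hj₀⟩ := Finset.exists_mem_eq_sup Finset.univ Finset.univ_nonempty
    fun j => Module.finrank ℝ (V j)
  have hle : ∀ j, N j ≤ N j₀ := by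
    intro j
    have h1 := Finset.le_sup (f := fun j => Module.finrank ℝ (V j)) (Finset.mem_univ j)
    rw [hj₀] at h1
    simp only [hN] at h1
    omega
  rw [hj₀, hN j₀]
  rcases Nat.even_or_odd' (N j₀) with ⟨p, hp | hp⟩
  · refine iff_of_true ?_ ⟨p, by omega⟩
    obtain ⟨C, hC, hCb⟩ := exists_norm_mulVec_le (E := E) (F := F) (H := H) hV
      fun j => ⟨w j, N j, hp ▸ hle j, hw j, hspan j⟩
    exact hS.preservesProperlyConvexDomain (hp ▸ hw j₀) hC hCb
  · refine iff_of_false ?_ (by rw [Nat.not_odd_iff_even]; exact ⟨p + 1, by omega⟩)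
    refine hS.not_preservesProperlyConvexDomain (N := N j₀) ⟨p, hp⟩ (fun x => ?_) fun h0 => ?_
    · have hx : x ∈ iSup V := hV ▸ Submodule.mem_top
      induction hx using Submodule.iSup_induction' with
      | mem j x hx =>
        rw [show N j₀ + 1 = (N j₀ - N j) + (N j + 1) by have := hle j; omega, pow_add,
          Module.End.mul_apply, (hw j).f_pow_succ_eq_zero (hspan j) hx, map_zero]
      | zero => simp
      | add x y _ _ hx hy => rw [map_add, hx, hy, add_zero]
    · exact (hw j₀).f_ne (LinearMap.congr_fun h0 _)

end Decomposition
/-! ### Normal subgroups of simple groups -/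

section ConnectedSubgroups

open scoped commutatorElement

variable {G : Type*} [Group G] [TopologicalSpace G] [IsTopologicalGroup G]

/-- The connected component of `1` in the generated subgroup is a subgroup that contains the
generators. -/
theorem isConnected_closure_of_isConnected {T : Set G} (hT : IsConnected T) (h1 : (1 : G) ∈ T) :
    IsConnected (Subgroup.closure T : Set G) := by
  set S : Set G := ((Subgroup.closure T : Subgroup G) : Set G) with hS
  have h1S : (1 : G) ∈ S := (Subgroup.closure T).one_mem
  set C := connectedComponentIn S 1 with hC
  have hCS : C ⊆ S := connectedComponentIn_subset S 1
  have h1C : (1 : G) ∈ C := mem_connectedComponentIn h1S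
  have hCp : IsPreconnected C := isPreconnected_connectedComponentIn
  have hmax : ∀ {D : Set G}, IsPreconnected D → D ⊆ S → ∀ {x}, x ∈ D → x ∈ C → D ⊆ C := by
    intro D hD hDS x hxD hxC
    have := hD.subset_connectedComponentIn hxD hDS
    rwa [← connectedComponentIn_eq hxC] at this
  have hmul : ∀ x ∈ C, ∀ y ∈ C, x * y ∈ C := by
    intro x hx y hy
    refine hmax (D := (fun z => x * z) '' C) (hCp.image _ (by fun_prop)) ?_ (x := x)
      ⟨1, h1C, mul_one x⟩ hx ⟨y, hy, rfl⟩
    rintro _ ⟨z, hz, rfl⟩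
    exact (Subgroup.closure T).mul_mem (hCS hx) (hCS hz)
  have hinv : ∀ x ∈ C, x⁻¹ ∈ C := by
    intro x hx
    refine hmax (D := (fun z => z⁻¹) '' C) (hCp.image _ (by fun_prop)) ?_ (x := 1)
      ⟨1, h1C, inv_one⟩ h1C ⟨x, hx, rfl⟩
    rintro _ ⟨z, hz, rfl⟩
    exact (Subgroup.closure T).inv_mem (hCS hz)
  have hSC : S ⊆ C := by
    intro x hx
    induction hx using Subgroup.closure_induction with
    | mem x hx => exact hmax hT.isPreconnected Subgroup.subset_closure h1 h1C hx
    | one => exact h1C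
    | mul x y _ _ hx hy => exact hmul x hx y hy
    | inv x _ hx => exact hinv x hx
  exact ⟨⟨1, h1S⟩, (Set.Subset.antisymm hSC hCS) ▸ hCp⟩

theorem isConnected_commutator_top [ConnectedSpace G] (N : Subgroup G) :
    IsConnected ((⁅(⊤ : Subgroup G), N⁆ : Subgroup G) : Set G) := by
  rw [Subgroup.commutator_def]
  have heq : {g | ∃ g₁ ∈ (⊤ : Subgroup G), ∃ g₂ ∈ N, ⁅g₁, g₂⁆ = g} =
      ⋃ n : N, Set.range fun g : G => ⁅g, (n : G)⁆ := by
    ext x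
    simp
    tauto
  have hmem : ∀ n : N, (1 : G) ∈ Set.range fun g : G => ⁅g, (n : G)⁆ := fun n => ⟨1, by simp⟩
  refine isConnected_closure_of_isConnected ?_ ⟨1, trivial, 1, N.one_mem, by simp⟩
  rw [heq]
  refine ⟨⟨1, Set.mem_iUnion.2 ⟨1, hmem 1⟩⟩, ?_⟩
  refine isPreconnected_iUnion ⟨1, Set.mem_iInter.2 hmem⟩ fun n => ?_
  simp only [commutatorElement_def]
  exact isPreconnected_range (by fun_prop)

/-- A simple group is perfect, because its commutator subgroup is connected. -/
theorem IsSimpleLie.commutator_eq_top (hG : IsSimpleLie G) : commutator G = ⊤ := by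
  obtain ⟨hconn, ⟨a, b, hab⟩, hN⟩ := hG
  refine (hN _ inferInstance (isConnected_commutator_top ⊤)).resolve_left fun h0 => hab ?_
  have h1 : ⁅a, b⁆ ∈ commutator G :=
    Subgroup.commutator_mem_commutator (Subgroup.mem_top _) (Subgroup.mem_top _)
  rw [commutator_def, h0, Subgroup.mem_bot] at h1
  exact commutatorElement_eq_one_iff_mul_comm.1 h1

/-- Proper normal subgroups of a simple group are central: the subgroup `[G, N]` is connected. -/
theorem IsSimpleLie.le_center (hG : IsSimpleLie G) {N : Subgroup G} [N.Normal] (hN : N ≠ ⊤) :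
    N ≤ Subgroup.center G := by
  obtain ⟨hconn, -, h⟩ := hG
  have h1 : ⁅(⊤ : Subgroup G), N⁆ ≤ N := Subgroup.commutator_le_right _ _
  have h2 : ⁅(⊤ : Subgroup G), N⁆ = ⊥ :=
    (h _ inferInstance (isConnected_commutator_top N)).resolve_right
      fun h3 => hN (top_le_iff.1 (h3 ▸ h1))
  intro n hn
  rw [Subgroup.mem_center_iff]
  intro g
  have h3 : ⁅g, n⁆ ∈ ⁅(⊤ : Subgroup G), N⁆ :=
    Subgroup.commutator_mem_commutator (Subgroup.mem_top _) hn
  rw [h2, Subgroup.mem_bot] at h3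
  exact commutatorElement_eq_one_iff_mul_comm.1 h3

end ConnectedSubgroups

/-! ### Lifting through homomorphisms with finite kernel -/

section Lifting

variable {P Q : Type*} [Group P] [TopologicalSpace P] [IsTopologicalGroup P] [T2Space P]
  [Group Q] [TopologicalSpace Q]

omit [TopologicalSpace Q] in
/-- Uniqueness of lifts: two lifts of a map on a preconnected set agree if they agree at a point,
since their quotient takes values in a finite group. -/
theorem eqOn_of_finite_ker (f : P →* Q) (hker : (f.ker : Set P).Finite) {X : Type*}
    [TopologicalSpace X] {s : Set X} (hs : IsPreconnected s) {x y : X → P} (hx : ContinuousOn x s)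
    (hy : ContinuousOn y s) (hxy : ∀ a ∈ s, f (x a) = f (y a)) {a₀ : X} (ha₀ : a₀ ∈ s)
    (h0 : x a₀ = y a₀) : Set.EqOn x y s := by
  intro a ha
  have : Finite (f.ker : Set P) := hker
  have h1 := hs.constant_of_mapsTo (T := (f.ker : Set P)) (f := fun a => x a * (y a)⁻¹)
    ⟨inferInstance⟩ (hx.mul hy.inv) (fun a ha => by
      rw [SetLike.mem_coe, MonoidHom.mem_ker, map_mul, map_inv, hxy a ha, mul_inv_cancel]) ha ha₀
  simp only [h0, mul_inv_cancel] at h1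
  exact mul_inv_eq_one.1 h1

/-- One-parameter groups lift through open surjections with finite kernel. -/
theorem exists_lift_oneParameter (f : P →* Q) (hf : Continuous f) (hopen : IsOpenMap f)
    (hsurj : Function.Surjective f) (hker : (f.ker : Set P).Finite) (c : ℝ → Q)
    (hc : Continuous c) (hcm : ∀ s t, c (s + t) = c s * c t) :
    ∃ c' : ℝ → P, Continuous c' ∧ (∀ s t, c' (s + t) = c' s * c' t) ∧ ∀ t, f (c' t) = c t := by
  have hfin : Finite (f.ker : Set P) := hker
  have hcov : IsCoveringMap f := ((hopen.isQuotientMap hf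
    hsurj).isQuotientCoveringMap_of_isDiscrete_ker_monoidHom ⟨inferInstance⟩).isCoveringMap
  have hc0 : c 0 = 1 := by
    have := hcm 0 0
    simpa using this
  obtain ⟨g, ⟨hg0, hg⟩, -⟩ := hcov.existsUnique_continuousMap_lifts ⟨c, hc⟩ 0 1 (by simp [hc0])
  have hg' : ∀ t, f (g t) = c t := fun t => congrFun hg t
  refine ⟨g, g.continuous, fun s t => ?_, hg'⟩
  have h1 := eqOn_of_finite_ker f hker (s := Set.univ) isPreconnected_univ
    (x := fun t => g (s + t)) (y := fun t => g s * g t) (by fun_prop) (by fun_prop)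
    (fun a _ => by simp [hg', hcm]) (Set.mem_univ 0) (by simp [hg0])
  exact h1 (Set.mem_univ t)

end Lifting
/-! ### Isometries of the upper half plane -/

section Hyperbolic

open UpperHalfPlane

theorem dist_eq_dist_iff (z w z' w' : ℍ) : dist z w = dist z' w' ↔
    ((z.re - w.re) ^ 2 + (z.im - w.im) ^ 2) * (z'.im * w'.im) =
      ((z'.re - w'.re) ^ 2 + (z'.im - w'.im) ^ 2) * (z.im * w.im) := by
  have h : ∀ z w : ℍ, dist (z : ℂ) w ^ 2 = (z.re - w.re) ^ 2 + (z.im - w.im) ^ 2 := fun z w => by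
    rw [Complex.dist_eq, Complex.sq_norm, Complex.normSq_apply]
    simp
    ring
  rw [← Real.cosh_injOn.eq_iff (Set.mem_Ici.2 dist_nonneg) (Set.mem_Ici.2 dist_nonneg)]
  rw [cosh_dist, cosh_dist, h, h]
  have := z.im_pos
  have := w.im_pos
  have := z'.im_pos
  have := w'.im_pos
  constructor
  · intro h1
    have h2 := add_left_cancel h1
    field_simp at h2
    linarith
  · intro h1
    congr 1
    field_simp
    linarith

theorem smul_re_im (B : SL(2, ℝ)) (z : ℍ) :
    (B • z).re = ((B 0 0 * z.re + B 0 1) * (B 1 0 * z.re + B 1 1) + B 0 0 * B 1 0 * z.im ^ 2) /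
      ((B 1 0 * z.re + B 1 1) ^ 2 + (B 1 0 * z.im) ^ 2) ∧
    (B • z).im = z.im / ((B 1 0 * z.re + B 1 1) ^ 2 + (B 1 0 * z.im) ^ 2) := by
  have hdet := B.det_coe
  rw [Matrix.det_fin_two] at hdet
  have h := coe_specialLinearGroup_apply B z
  have hre := congrArg Complex.re h
  have him := congrArg Complex.im h
  simp [Complex.div_re, Complex.div_im, Complex.normSq_apply] at hre him
  constructor
  · rw [hre]
    ring
  · rw [him, div_sub_div_same]
    congr 1
    · linear_combination z.im * hdet
    · ring

/-- The matrix `!![a, b; c, d]` as an element of `SL(2, ℝ)`. -/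
def sl2Mk (a b c d : ℝ) (h : a * d - b * c = 1) : SL(2, ℝ) :=
  ⟨!![a, b; c, d], by rw [Matrix.det_fin_two_of]; exact h⟩

section sl2Mk

variable (a b c d : ℝ) (h : a * d - b * c = 1)

@[simp] theorem sl2Mk_val : (sl2Mk a b c d h).val = !![a, b; c, d] := rfl
@[simp] theorem sl2Mk_00 : (sl2Mk a b c d h) 0 0 = a := rfl
@[simp] theorem sl2Mk_01 : (sl2Mk a b c d h) 0 1 = b := rfl
@[simp] theorem sl2Mk_10 : (sl2Mk a b c d h) 1 0 = c := rfl
@[simp] theorem sl2Mk_11 : (sl2Mk a b c d h) 1 1 = d := rfl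

end sl2Mk

theorem ext_re_im {z w : ℍ} (h1 : z.re = w.re) (h2 : z.im = w.im) : z = w := by
  ext1
  exact Complex.ext h1 h2

/-- Every point can be rotated around `I` to the imaginary axis. -/
theorem exists_rotation_re_eq_zero (w : ℍ) :
    ∃ B : SL(2, ℝ), B • I = I ∧ (B • w).re = 0 := by
  have hc : ContinuousOn (fun θ : ℝ => (Real.cos θ * w.re - Real.sin θ) *
      (Real.sin θ * w.re + Real.cos θ) + Real.cos θ * Real.sin θ * w.im ^ 2)
      (Set.uIcc 0 (Real.pi / 2)) := by fun_prop
  -- rotation by the angles `0` and `π / 2` gives real parts of opposite signs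
  have hmem : (0 : ℝ) ∈ Set.uIcc w.re (-w.re) := by
    rcases le_total 0 w.re with h | h
    · exact Set.mem_uIcc.2 (.inr ⟨by linarith, h⟩)
    · exact Set.mem_uIcc.2 (.inl ⟨h, by linarith⟩)
  have h := intermediate_value_uIcc hc
  simp only [Real.cos_zero, Real.sin_zero, Real.cos_pi_div_two, Real.sin_pi_div_two, one_mul,
    zero_mul, sub_zero, zero_add, mul_one, add_zero, zero_sub, mul_zero, neg_mul] at h
  obtain ⟨θ, -, hθ⟩ := h hmem
  have hcs := Real.cos_sq_add_sin_sq θ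
  refine ⟨sl2Mk (Real.cos θ) (-Real.sin θ) (Real.sin θ) (Real.cos θ) (by linarith),
    ext_re_im ?_ ?_, ?_⟩
  · rw [(smul_re_im _ _).1]
    simp
    ring
  · rw [(smul_re_im _ _).2]
    simp
  · rw [(smul_re_im _ _).1]
    simp only [sl2Mk_00, sl2Mk_01, sl2Mk_10, sl2Mk_11, ← sub_eq_add_neg]
    rw [div_eq_zero_iff]
    left
    exact hθ

/-- An isometry fixing `I` and another point of the imaginary axis is the identity or the
reflection in that axis. -/
theorem eq_id_or_eq_reflection (φ : ℍ → ℍ) (hφ : ∀ z w, dist (φ z) (φ w) = dist z w)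
    (hI : φ I = I) {w : ℍ} (hw0 : w.re = 0) (hw1 : w.im ≠ 1) (hw : φ w = w) :
    (∀ z, φ z = z) ∨ (∀ z, φ z = J • z) := by
  have hJ : ∀ z : ℍ, (J • z).re = -z.re ∧ (J • z).im = z.im := by
    intro z
    have := coe_J_smul z
    exact ⟨by simpa using congrArg Complex.re this, by simpa using congrArg Complex.im this⟩
  have hpt : ∀ z, (φ z).im = z.im ∧ (φ z).re ^ 2 = z.re ^ 2 := by
    intro z
    have h1 := hφ z I
    have h2 := hφ z w
    rw [hI, dist_eq_dist_iff] at h1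
    rw [hw, dist_eq_dist_iff, hw0] at h2
    simp only [I_re, I_im] at h1
    have hz := z.im_pos
    have hwp := w.im_pos
    have h2' : (((φ z).re - 0) ^ 2 + ((φ z).im - w.im) ^ 2) * z.im =
        ((z.re - 0) ^ 2 + (z.im - w.im) ^ 2) * (φ z).im := by
      have : w.im * ((((φ z).re - 0) ^ 2 + ((φ z).im - w.im) ^ 2) * z.im) =
        w.im * (((z.re - 0) ^ 2 + (z.im - w.im) ^ 2) * (φ z).im) := by linear_combination h2
      exact mul_left_cancel₀ hwp.ne' this
    have h3 : (1 - w.im ^ 2) * (z.im - (φ z).im) = 0 := by linear_combination h1 - h2'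
    have h4 : 1 - w.im ^ 2 ≠ 0 := by
      intro h
      have : (w.im - 1) * (w.im + 1) = 0 := by linarith
      rcases mul_eq_zero.1 this with h | h
      · exact hw1 (by linarith)
      · linarith
    have h5 : (φ z).im = z.im := by
      have := (mul_eq_zero.1 h3).resolve_left h4
      linarith
    refine ⟨h5, ?_⟩
    rw [h5] at h1
    have : z.im * ((φ z).re ^ 2) = z.im * z.re ^ 2 := by linear_combination h1
    exact mul_left_cancel₀ hz.ne' this
  by_contra! hcon
  obtain ⟨⟨z, hz⟩, ⟨z', hz'⟩⟩ := hcon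
  have h1 : (φ z).re = -z.re ∧ z.re ≠ 0 := by
    rcases sq_eq_sq_iff_eq_or_eq_neg.1 (hpt z).2 with h | h
    · exact absurd (ext_re_im h (hpt z).1) hz
    · refine ⟨h, fun h0 => hz (ext_re_im ?_ (hpt z).1)⟩
      rw [h, h0, neg_zero]
  have h2 : (φ z').re = z'.re ∧ z'.re ≠ 0 := by
    rcases sq_eq_sq_iff_eq_or_eq_neg.1 (hpt z').2 with h | h
    · refine ⟨h, fun h0 => hz' (ext_re_im ?_ ?_)⟩
      · rw [h, h0, (hJ z').1, h0, neg_zero]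
      · rw [(hpt z').1, (hJ z').2]
    · exact absurd (ext_re_im (h.trans (hJ z').1.symm) ((hpt z').1.trans (hJ z').2.symm)) hz'
  have h3 := hφ z z'
  rw [dist_eq_dist_iff, h1.1, h2.1, (hpt z).1, (hpt z').1] at h3
  have h4 : (4 * z.im * z'.im) * (z.re * z'.re) = 0 := by linear_combination h3
  have h5 := z.im_pos
  have h6 := z'.im_pos
  exact mul_ne_zero (by positivity) (mul_ne_zero h1.2 h2.2) h4

/-- Isometries of the upper half plane are Möbius or anti-Möbius transformations. -/
theorem exists_GL_smul_eq_of_isometry (φ : ℍ → ℍ) (hφ : ∀ z w, dist (φ z) (φ w) = dist z w) :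
    ∃ B : GL (Fin 2) ℝ, ∀ z, φ z = B • z := by
  obtain ⟨B₁, hB₁⟩ := MulAction.exists_smul_eq SL(2, ℝ) (φ I) I
  let w₀ : ℍ := ⟨⟨0, 2⟩, by norm_num⟩
  obtain ⟨B₂, hB₂I, hB₂⟩ := exists_rotation_re_eq_zero (B₁ • φ w₀)
  set ψ : ℍ → ℍ := fun z => B₂ • B₁ • φ z with hψ
  have hψd : ∀ z w, dist (ψ z) (ψ w) = dist z w := fun z w => by
    simp only [hψ, dist_smul, hφ]
  have hψI : ψ I = I := by simp only [hψ, hB₁, hB₂I]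
  -- the image of `2 i` is `2 i` or `i / 2`; in the second case, apply `z ↦ -1 / z`
  obtain ⟨B₃, hB₃I, hB₃⟩ : ∃ B : SL(2, ℝ), B • I = I ∧ B • ψ w₀ = w₀ := by
    have h1 := hψd w₀ I
    rw [hψI, dist_eq_dist_iff] at h1
    have h0 : (ψ w₀).re = 0 := hB₂
    have hre : w₀.re = 0 := rfl
    have him : w₀.im = 2 := rfl
    have hpos := (ψ w₀).im_pos
    rw [h0, hre, him] at h1
    simp only [I_re, I_im] at h1
    have h2 : ((ψ w₀).im - 2) * (2 * (ψ w₀).im - 1) = 0 := by linear_combination h1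
    rcases mul_eq_zero.1 h2 with h | h
    · refine ⟨1, one_smul _ _, ?_⟩
      rw [one_smul]
      exact ext_re_im (h0.trans hre.symm) (by rw [him]; linarith)
    · have him' : (ψ w₀).im = 1 / 2 := by linarith
      refine ⟨sl2Mk 0 (-1) 1 0 (by norm_num), ext_re_im ?_ ?_, ext_re_im ?_ ?_⟩
      · rw [(smul_re_im _ _).1]; simp
      · rw [(smul_re_im _ _).2]; simp
      · rw [(smul_re_im _ _).1, h0, hre]; simp
      · rw [(smul_re_im _ _).2, h0, him', him]; norm_num
  have hid := eq_id_or_eq_reflection (fun z => B₃ • ψ z)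
    (fun z w => by rw [dist_smul, hψd]) (by simp only [hψI, hB₃I]) (w := w₀) rfl
    (show (2 : ℝ) ≠ 1 by norm_num) hB₃
  have hinv : ∀ z, φ z = (B₃ * B₂ * B₁)⁻¹ • (B₃ • ψ z) := by
    intro z
    rw [eq_inv_smul_iff, mul_smul, mul_smul]
  rcases hid with h | h
  · exact ⟨((B₃ * B₂ * B₁)⁻¹ : SL(2, ℝ)), fun z => by rw [hinv, h]; rfl⟩
  · exact ⟨((B₃ * B₂ * B₁)⁻¹ : SL(2, ℝ)) * J, fun z => by rw [hinv, h, mul_smul]; rfl⟩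

end Hyperbolic
/-! ### The action of `SL(2, ℝ)` on the upper half plane -/

section SL2

open UpperHalfPlane

theorem det_eq (B : SL(2, ℝ)) : B 0 0 * B 1 1 - B 0 1 * B 1 0 = 1 := by
  have := B.det_coe
  rwa [Matrix.det_fin_two] at this

theorem sl2_ext {A B : SL(2, ℝ)} (h00 : A 0 0 = B 0 0) (h01 : A 0 1 = B 0 1)
    (h10 : A 1 0 = B 1 0) (h11 : A 1 1 = B 1 1) : A = B := by
  ext i j
  fin_cases i <;> fin_cases j <;> assumption

/-- The norm of a matrix measures how far it moves `I`. -/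
theorem normSq_eq_two_mul_cosh (B : SL(2, ℝ)) : normSq B = 2 * Real.cosh (dist (B • I) I) := by
  have hdet := det_eq B
  have hD : 0 < B 1 1 ^ 2 + B 1 0 ^ 2 := by
    by_contra h
    have h1 : B 1 1 = 0 := by nlinarith [sq_nonneg (B 1 1), sq_nonneg (B 1 0)]
    have h2 : B 1 0 = 0 := by nlinarith [sq_nonneg (B 1 1), sq_nonneg (B 1 0)]
    simp [h1, h2] at hdet
  have h : dist ((B • I : ℍ) : ℂ) (I : ℍ) ^ 2 = (B • I).re ^ 2 + ((B • I).im - 1) ^ 2 := by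
    rw [Complex.dist_eq, Complex.sq_norm, Complex.normSq_apply]
    simp
    ring
  rw [cosh_dist, h, (smul_re_im B I).1, (smul_re_im B I).2, normSq]
  simp only [I_re, I_im, mul_zero, zero_add, one_pow, mul_one]
  field_simp
  have h1 : B 0 0 * B 1 1 = 1 + B 0 1 * B 1 0 := by linarith
  have h2 : (B 0 1 * B 1 1 + B 0 0 * B 1 0) ^ 2 + 1 =
      (B 0 0 ^ 2 + B 0 1 ^ 2) * (B 1 0 ^ 2 + B 1 1 ^ 2) := by
    linear_combination -(B 0 0 * B 1 1 - B 0 1 * B 1 0 + 1) * hdet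
  linear_combination -h2

theorem eq_one_or_eq_neg_one_of_smul_eq {B : SL(2, ℝ)} (h : ∀ z : ℍ, B • z = z) :
    B = 1 ∨ B = -1 := by
  have hdet := det_eq B
  obtain ⟨w, hre, him⟩ : ∃ w : ℍ, w.re = 0 ∧ w.im = 2 := ⟨⟨⟨0, 2⟩, by norm_num⟩, rfl, rfl⟩
  have h1i := (smul_re_im B I).2
  have h2i := (smul_re_im B w).2
  have h1r := (smul_re_im B I).1
  rw [h I] at h1i h1r
  rw [h w, hre, him] at h2i
  simp only [I_re, I_im, mul_zero, zero_add, mul_one, one_pow] at h1i h2i h1r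
  have h3 : B 1 1 ^ 2 + B 1 0 ^ 2 = 1 := by
    rcases eq_or_ne (B 1 1 ^ 2 + B 1 0 ^ 2) 0 with h0 | h0
    · rw [h0] at h1i; norm_num at h1i
    · rw [eq_div_iff h0] at h1i; linarith
  have h4 : B 1 1 ^ 2 + (B 1 0 * 2) ^ 2 = 1 := by
    rcases eq_or_ne (B 1 1 ^ 2 + (B 1 0 * 2) ^ 2) 0 with h0 | h0
    · rw [h0] at h2i; norm_num at h2i
    · rw [eq_div_iff h0] at h2i; linarith
  have hc : B 1 0 = 0 := by
    have : B 1 0 ^ 2 = 0 := by linarith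
    exact pow_eq_zero_iff (two_ne_zero) |>.1 this
  rw [hc] at h3 h1r hdet
  have hd : B 1 1 ^ 2 = 1 := by linarith
  simp only [mul_zero, add_zero, sub_zero] at h1r hdet
  have hd0 : B 1 1 ≠ 0 := fun h => by rw [h] at hd; norm_num at hd
  have hb : B 0 1 = 0 := by
    have h5 := div_eq_zero_iff.1 h1r.symm
    rcases h5 with h5 | h5
    · exact (mul_eq_zero.1 h5).resolve_right hd0
    · norm_num [hd] at h5
  rcases (sq_eq_sq_iff_eq_or_eq_neg (b := (1 : ℝ))).1 (by rw [hd, one_pow]) with h6 | h6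
  · left
    rw [h6, mul_one] at hdet
    exact sl2_ext (by simpa using hdet) (by simpa using hb) (by simpa using hc) (by simpa using h6)
  · right
    rw [h6] at hdet
    have ha : B 0 0 = -1 := by linarith
    exact sl2_ext (by simpa using ha) (by simpa using hb) (by simpa using hc) (by simpa using h6)

/-- The action of `SL(2, ℝ)` on the upper half plane is proper. -/
theorem isCompact_setOf_smul_I_mem {C : Set ℍ} (hC : IsCompact C) :
    IsCompact {B : SL(2, ℝ) | B • I ∈ C} := by
  obtain ⟨r, hr⟩ := hC.isBounded.subset_closedBall I
  set R := √(2 * Real.cosh r)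
  have hbox : IsCompact {M : Matrix (Fin 2) (Fin 2) ℝ | ∀ i j, M i j ∈ Set.Icc (-R) R} := by
    have := isCompact_univ_pi fun _ : Fin 2 => isCompact_univ_pi fun _ : Fin 2 =>
      isCompact_Icc (a := -R) (b := R)
    have heq : {M : Matrix (Fin 2) (Fin 2) ℝ | ∀ i j, M i j ∈ Set.Icc (-R) R} =
        Set.univ.pi fun _ : Fin 2 => Set.univ.pi fun _ : Fin 2 => Set.Icc (-R) R :=
      Set.ext fun M => ⟨fun h i _ j _ => h i j, fun h i j => h i trivial j trivial⟩
    rw [heq]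
    exact this
  refine (Matrix.SpecialLinearGroup.isClosedEmbedding_val.isCompact_preimage
    hbox).of_isClosed_subset (hC.isClosed.preimage (by fun_prop)) fun (B : SL(2, ℝ)) hB => ?_
  have h1 : dist (B • I) I ≤ r := hr hB
  have h2 : normSq B ≤ 2 * Real.cosh r := by
    rw [normSq_eq_two_mul_cosh]
    have : Real.cosh (dist (B • I) I) ≤ Real.cosh r := by
      rw [Real.cosh_le_cosh, abs_of_nonneg dist_nonneg]
      exact h1.trans (le_abs_self r)
    linarith
  have h3 : ∀ x : ℝ, x ^ 2 ≤ normSq B → x ∈ Set.Icc (-R) R := fun x hx =>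
    abs_le.1 (Real.abs_le_sqrt (hx.trans h2))
  rw [normSq] at h3
  intro i j
  fin_cases i <;> fin_cases j <;> refine h3 _ ?_ <;>
    simp only [Fin.zero_eta, Fin.mk_one] <;>
    nlinarith [sq_nonneg (B 0 0), sq_nonneg (B 0 1), sq_nonneg (B 1 0), sq_nonneg (B 1 1)]

instance : LocallyCompactSpace SL(2, ℝ) :=
  have : LocallyCompactSpace (Matrix (Fin 2) (Fin 2) ℝ) :=
    inferInstanceAs (LocallyCompactSpace (Fin 2 → Fin 2 → ℝ))
  Matrix.SpecialLinearGroup.isClosedEmbedding_val.locallyCompactSpace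

instance : SigmaCompactSpace SL(2, ℝ) :=
  have : SigmaCompactSpace (Matrix (Fin 2) (Fin 2) ℝ) :=
    inferInstanceAs (SigmaCompactSpace (Fin 2 → Fin 2 → ℝ))
  Matrix.SpecialLinearGroup.isClosedEmbedding_val.sigmaCompactSpace

end SL2

/-! ### Proper isometric actions on the upper half plane -/

section Action

open UpperHalfPlane
open scoped commutatorElement

/-- A continuous, transitive and proper action by isometries of the upper half plane. Properness
is stated for the orbit of `I`, which suffices for a transitive isometric action. -/
structure IsProperIsometricAction (G : Type*) [Group G] [TopologicalSpace G] [MulAction G ℍ] :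
    Prop where
  continuous_smul : Continuous fun p : G × ℍ => p.1 • p.2
  dist_smul : ∀ (g : G) (z w : ℍ), dist (g • z) (g • w) = dist z w
  exists_smul_eq : ∀ z w : ℍ, ∃ g : G, g • z = w
  isCompact : ∀ C : Set ℍ, IsCompact C → IsCompact {g : G | g • I ∈ C}

/-- The pairs of an element of `G` and an element of `L` that act on `X` in the same way. -/
def actionPairs (G L X : Type*) [Group G] [Group L] [MulAction G X] [MulAction L X] :
    Subgroup (G × L) where
  carrier := {p | ∀ z : X, p.1 • z = p.2 • z}
  one_mem' := by simp
  mul_mem' := by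
    intro p q hp hq z
    simp only [Prod.fst_mul, Prod.snd_mul, mul_smul]
    rw [hq, hp]
  inv_mem' := by
    intro p hp z
    simp only [Prod.fst_inv, Prod.snd_inv]
    rw [inv_smul_eq_iff, hp, smul_inv_smul]

/-- If `G` is perfect and all its elements have partners in `T`, they have partners in every
subgroup that contains the commutators of `T`. -/
theorem exists_mem_of_commutator_le {G L : Type*} [Group G] [Group L] (hG : commutator G = ⊤)
    (Q : Subgroup (G × L)) {T T' : Subgroup L} (hT : ∀ g, ∃ B ∈ T, (g, B) ∈ Q)
    (hTT' : ∀ a ∈ T, ∀ b ∈ T, ⁅a, b⁆ ∈ T') (g : G) : ∃ B ∈ T', (g, B) ∈ Q := by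
  let M : Subgroup G := (Q ⊓ Subgroup.prod ⊤ T').map (MonoidHom.fst G L)
  have hM : M = ⊤ := by
    rw [eq_top_iff, ← hG, commutator_def, Subgroup.commutator_le]
    intro a _ b _
    obtain ⟨A, hA, haA⟩ := hT a
    obtain ⟨B, hB, hbB⟩ := hT b
    refine ⟨⁅(a, A), (b, B)⁆, ⟨?_, ?_⟩, rfl⟩
    · exact Q.mul_mem (Q.mul_mem (Q.mul_mem haA hbB) (Q.inv_mem haA)) (Q.inv_mem hbB)
    · exact Subgroup.mem_prod.2 ⟨Subgroup.mem_top _, hTT' A hA B hB⟩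
  obtain ⟨⟨g', B⟩, ⟨h1, h2⟩, rfl⟩ : g ∈ M := hM ▸ Subgroup.mem_top g
  exact ⟨B, (Subgroup.mem_prod.1 h2).2, h1⟩

variable {G : Type*} [Group G] [TopologicalSpace G] [IsTopologicalGroup G] [MulAction G ℍ]

/-- Elements of `G` act like matrices in `GL(2, ℝ)`, and products of commutators of such matrices
have determinant `1`. -/
theorem IsProperIsometricAction.exists_SL2 (hA : IsProperIsometricAction G)
    (hG : IsSimpleLie G) (g : G) : ∃ B : SL(2, ℝ), (g, B) ∈ actionPairs G SL(2, ℝ) ℍ := by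
  have h1 : ∀ g : G, ∃ B ∈ (⊤ : Subgroup (GL (Fin 2) ℝ)),
      (g, B) ∈ actionPairs G (GL (Fin 2) ℝ) ℍ := by
    intro g
    obtain ⟨B, hB⟩ := exists_GL_smul_eq_of_isometry (fun z => g • z) (hA.dist_smul g)
    exact ⟨B, Subgroup.mem_top _, hB⟩
  obtain ⟨B, hB, hgB⟩ := exists_mem_of_commutator_le hG.commutator_eq_top _ h1
    (T' := (Matrix.GeneralLinearGroup.det (n := Fin 2) (R := ℝ)).ker)
    (fun a _ b _ => by
      rw [MonoidHom.mem_ker, map_commutatorElement, commutatorElement_eq_one_iff_mul_comm,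
        mul_comm]) g
  have hdet : B.val.det = 1 := congrArg Units.val (MonoidHom.mem_ker.1 hB)
  let B' : SL(2, ℝ) := ⟨B.val, hdet⟩
  have hBB' : B = Matrix.SpecialLinearGroup.toGL B' := Units.ext rfl
  refine ⟨B', fun z => (hgB z).trans ?_⟩
  simp only [hBB']
  rfl

/-- The elements acting trivially are central, because they form a proper normal subgroup. -/
theorem IsProperIsometricAction.mem_center (hA : IsProperIsometricAction G)
    (hG : IsSimpleLie G) {g : G} (hg : ∀ z : ℍ, g • z = z) : g ∈ Subgroup.center G := by
  refine hG.le_center (N := (MulAction.toPermHom G ℍ).ker) (fun h0 => ?_)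
    (MonoidHom.mem_ker.2 (Equiv.ext hg))
  obtain ⟨g, hg⟩ := hA.exists_smul_eq I ⟨⟨0, 2⟩, by norm_num⟩
  have h1 : g ∈ (MulAction.toPermHom G ℍ).ker := h0 ▸ Subgroup.mem_top g
  have h2 : g • I = I := Equiv.congr_fun (MonoidHom.mem_ker.1 h1) I
  rw [h2] at hg
  have h3 : (1 : ℝ) = 2 := congrArg UpperHalfPlane.im hg
  norm_num at h3

end Action
/-! ### Triangular matrices in `SL(2, ℝ)` -/

section Triangular

open scoped commutatorElement

theorem sl2_mul_apply (A B : SL(2, ℝ)) (i j : Fin 2) :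
    (A * B) i j = A i 0 * B 0 j + A i 1 * B 1 j := by
  rw [Matrix.SpecialLinearGroup.coe_mul, Matrix.mul_apply, Fin.sum_univ_two]

theorem sl2_inv_apply (A : SL(2, ℝ)) :
    A⁻¹ 0 0 = A 1 1 ∧ A⁻¹ 0 1 = -A 0 1 ∧ A⁻¹ 1 0 = -A 1 0 ∧ A⁻¹ 1 1 = A 0 0 := by
  rw [Matrix.SpecialLinearGroup.coe_inv, Matrix.adjugate_fin_two]
  simp

/-- The lower triangular matrices in `SL(2, ℝ)`. -/
def lowerTriangular : Subgroup SL(2, ℝ) where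
  carrier := {X | X 0 1 = 0}
  one_mem' := by simp
  mul_mem' := by
    intro a b ha hb
    simp only [Set.mem_ofPred_eq] at ha hb ⊢
    rw [sl2_mul_apply, ha, hb]
    ring
  inv_mem' := by
    intro a ha
    simp only [Set.mem_ofPred_eq] at ha ⊢
    rw [(sl2_inv_apply a).2.1, ha, neg_zero]

/-- The unipotent lower triangular matrices in `SL(2, ℝ)`. -/
def lowerUnipotent : Subgroup SL(2, ℝ) where
  carrier := {X | X 0 1 = 0 ∧ X 0 0 = 1 ∧ X 1 1 = 1}
  one_mem' := by simp
  mul_mem' := by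
    rintro a b ⟨ha, ha', ha''⟩ ⟨hb, hb', hb''⟩
    refine ⟨?_, ?_, ?_⟩ <;> simp only [sl2_mul_apply, ha, ha', ha'', hb, hb', hb''] <;> ring
  inv_mem' := by
    rintro a ⟨ha, ha', ha''⟩
    obtain ⟨h1, h2, -, h3⟩ := sl2_inv_apply a
    exact ⟨by rw [h2, ha, neg_zero], by rw [h1, ha''], by rw [h3, ha']⟩

theorem mem_lowerUnipotent {X : SL(2, ℝ)} :
    X ∈ lowerUnipotent ↔ X 0 1 = 0 ∧ X 0 0 = 1 ∧ X 1 1 = 1 := Iff.rfl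

theorem commutator_mem_lowerUnipotent {a b : SL(2, ℝ)} (ha : a ∈ lowerTriangular)
    (hb : b ∈ lowerTriangular) : ⁅a, b⁆ ∈ lowerUnipotent := by
  have ha : a 0 1 = 0 := ha
  have hb : b 0 1 = 0 := hb
  have hda := det_eq a
  have hdb := det_eq b
  rw [ha, zero_mul, sub_zero] at hda
  rw [hb, zero_mul, sub_zero] at hdb
  obtain ⟨a1, a2, a3, a4⟩ := sl2_inv_apply a
  obtain ⟨b1, b2, b3, b4⟩ := sl2_inv_apply b
  rw [commutatorElement_def, mem_lowerUnipotent]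
  refine ⟨?_, ?_, ?_⟩ <;>
    simp only [sl2_mul_apply, a1, a2, a3, a4, b1, b2, b3, b4, ha, hb]
  · ring
  · linear_combination (b 0 0 * b 1 1) * hda + hdb
  · linear_combination (b 0 0 * b 1 1) * hda + hdb

theorem commutator_eq_one_of_mem_lowerUnipotent {a b : SL(2, ℝ)} (ha : a ∈ lowerUnipotent)
    (hb : b ∈ lowerUnipotent) : ⁅a, b⁆ = 1 := by
  obtain ⟨ha, ha', ha''⟩ := mem_lowerUnipotent.1 ha
  obtain ⟨hb, hb', hb''⟩ := mem_lowerUnipotent.1 hb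
  rw [commutatorElement_eq_one_iff_mul_comm]
  apply sl2_ext <;> simp only [sl2_mul_apply, ha, ha', ha'', hb, hb', hb''] <;> ring

end Triangular

/-! ### The two projections of `actionPairs` -/

section Projections

open UpperHalfPlane Topology

variable {G : Type*} [Group G] [TopologicalSpace G] [IsTopologicalGroup G] [MulAction G ℍ]

/-- The projection of `actionPairs` to `G`. -/
noncomputable def pairFst (G : Type*) [Group G] [MulAction G ℍ] : actionPairs G SL(2, ℝ) ℍ →* G :=
  (MonoidHom.fst G SL(2, ℝ)).comp (actionPairs G SL(2, ℝ) ℍ).subtype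

/-- The projection of `actionPairs` to `SL(2, ℝ)`. -/
noncomputable def pairSnd (G : Type*) [Group G] [MulAction G ℍ] :
    actionPairs G SL(2, ℝ) ℍ →* SL(2, ℝ) :=
  (MonoidHom.snd G SL(2, ℝ)).comp (actionPairs G SL(2, ℝ) ℍ).subtype

omit [IsTopologicalGroup G] in
theorem continuous_pairFst : Continuous (pairFst G) := continuous_fst.comp continuous_subtype_val

omit [IsTopologicalGroup G] in
theorem continuous_pairSnd : Continuous (pairSnd G) := continuous_snd.comp continuous_subtype_val

/-- The kernel consists of `(1, 1)` and `(1, -1)`. -/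
theorem finite_ker_pairFst (G : Type*) [Group G] [MulAction G ℍ] :
    ((pairFst G).ker : Set (actionPairs G SL(2, ℝ) ℍ)).Finite := by
  refine Set.Finite.of_finite_image (f := pairSnd G) ((Set.toFinite {1, -1}).subset ?_) ?_
  · rintro _ ⟨⟨⟨g, B⟩, hgB⟩, hg, rfl⟩
    have hg : g = 1 := hg
    subst hg
    exact eq_one_or_eq_neg_one_of_smul_eq fun z => by
      have := hgB z
      rw [one_smul] at this
      exact this.symm
  · rintro ⟨⟨g, B⟩, hgB⟩ hg ⟨⟨g', B'⟩, hgB'⟩ hg' h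
    have hg : g = 1 := hg
    have hg' : g' = 1 := hg'
    exact Subtype.ext (Prod.ext (hg.trans hg'.symm) h)

namespace IsProperIsometricAction

variable (hA : IsProperIsometricAction G) (hG : IsSimpleLie G)
include hA

omit [IsTopologicalGroup G] in
theorem isClosed_actionPairs : IsClosed (actionPairs G SL(2, ℝ) ℍ : Set (G × SL(2, ℝ))) := by
  have : (actionPairs G SL(2, ℝ) ℍ : Set (G × SL(2, ℝ))) =
      ⋂ z : ℍ, {p | p.1 • z = p.2 • z} := by
    ext p
    simp only [Set.mem_iInter]
    rfl
  rw [this]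
  refine isClosed_iInter fun z => isClosed_eq ?_ (by fun_prop)
  exact hA.continuous_smul.comp (by fun_prop : Continuous fun p : G × SL(2, ℝ) => (p.1, z))

omit [IsTopologicalGroup G] in
theorem sigmaCompactSpace : SigmaCompactSpace G := by
  refine ⟨⟨fun n => {g : G | g • I ∈ compactCovering ℍ n},
    fun n => hA.isCompact _ (isCompact_compactCovering ℍ n), ?_⟩⟩
  ext g
  simp only [Set.mem_iUnion, Set.mem_univ, iff_true]
  exact exists_mem_compactCovering (g • I)

omit [IsTopologicalGroup G] in
theorem sigmaCompactSpace_actionPairs : SigmaCompactSpace (actionPairs G SL(2, ℝ) ℍ) :=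
  have := hA.sigmaCompactSpace
  hA.isClosed_actionPairs.isClosedEmbedding_subtypeVal.sigmaCompactSpace

omit [IsTopologicalGroup G] in
/-- The group of matrices acting on the upper half plane like elements of `G` is closed. -/
theorem isClosed_range_pairSnd : IsClosed ((pairSnd G).range : Set SL(2, ℝ)) := by
  refine isClosed_of_closure_subset fun B hB => ?_
  let C := Metric.closedBall (B • I) 1
  have hC : IsCompact C := isCompact_closedBall _ _
  let D : Set (G × SL(2, ℝ)) := ({g : G | g • I ∈ C} ×ˢ {B' : SL(2, ℝ) | B' • I ∈ C}) ∩
    (actionPairs G SL(2, ℝ) ℍ : Set (G × SL(2, ℝ)))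
  have hD : IsCompact D := ((hA.isCompact C hC).prod (isCompact_setOf_smul_I_mem hC)).inter_right
    hA.isClosed_actionPairs
  have hDc : IsClosed (Prod.snd '' D) := (hD.image continuous_snd).isClosed
  have hDR : Prod.snd '' D ⊆ ((pairSnd G).range : Set SL(2, ℝ)) := by
    rintro _ ⟨p, hp, rfl⟩
    exact ⟨⟨p, hp.2⟩, rfl⟩
  apply hDR
  rw [← hDc.closure_eq, mem_closure_iff_nhds]
  intro W hW
  have hO : {B' : SL(2, ℝ) | B' • I ∈ Metric.ball (B • I) 1} ∈ 𝓝 B :=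
    (Metric.isOpen_ball.preimage (by fun_prop : Continuous fun B' : SL(2, ℝ) => B' • I)).mem_nhds
      (Metric.mem_ball_self one_pos)
  obtain ⟨_, ⟨hW', hO'⟩, ⟨⟨⟨g, B'⟩, hgB⟩, rfl⟩⟩ :=
    mem_closure_iff_nhds.1 hB _ (Filter.inter_mem hW hO)
  have h1 : B' • I ∈ C := Metric.ball_subset_closedBall hO'
  exact ⟨B', hW', ⟨⟨g, B'⟩, ⟨⟨by rw [Set.mem_ofPred_eq, hgB I]; exact h1, h1⟩, hgB⟩, rfl⟩⟩

include hG

theorem surjective_pairFst : Function.Surjective (pairFst G) := fun g => by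
  obtain ⟨B, hB⟩ := hA.exists_SL2 hG g
  exact ⟨⟨(g, B), hB⟩, rfl⟩

/-- The kernel consists of elements of the center of `G`. -/
theorem finite_ker_pairSnd (hZ : Finite (Subgroup.center G)) :
    ((pairSnd G).ker : Set (actionPairs G SL(2, ℝ) ℍ)).Finite := by
  refine Set.Finite.of_finite_image (f := pairFst G)
    ((Set.toFinite (Subgroup.center G : Set G)).subset ?_) ?_
  · rintro _ ⟨⟨⟨g, B⟩, hgB⟩, hg, rfl⟩
    have hg : B = 1 := hg
    subst hg
    exact hA.mem_center hG fun z => by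
      have := hgB z
      rw [one_smul] at this
      exact this
  · rintro ⟨⟨g, B⟩, hgB⟩ hg ⟨⟨g', B'⟩, hgB'⟩ hg' h
    have hg : B = 1 := hg
    have hg' : B' = 1 := hg'
    exact Subtype.ext (Prod.ext h (hg.trans hg'.symm))

variable [T2Space G] [LocallyCompactSpace G]

theorem isOpenMap_pairFst : IsOpenMap (pairFst G) :=
  have := hA.sigmaCompactSpace_actionPairs
  MonoidHom.isOpenMap_of_sigmaCompact _ (hA.surjective_pairFst hG) continuous_pairFst

/-- `actionPairs` is a finite covering of `G`, so it is locally connected. -/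
theorem exists_isPreconnected_nhds [LocallyConnectedSpace G]
    {O : Set (actionPairs G SL(2, ℝ) ℍ)} (hO : O ∈ 𝓝 1) :
    ∃ U ⊆ O, IsPreconnected U ∧ U ∈ 𝓝 1 := by
  have hfin : Finite ((pairFst G).ker : Set (actionPairs G SL(2, ℝ) ℍ)) := finite_ker_pairFst G
  have hloc : IsLocalHomeomorph (pairFst G) := (((hA.isOpenMap_pairFst hG).isQuotientMap
    continuous_pairFst (hA.surjective_pairFst hG)).isQuotientCoveringMap_of_isDiscrete_ker_monoidHom
    ⟨inferInstance⟩).isCoveringMap.isLocalHomeomorph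
  obtain ⟨e, he1, he⟩ := hloc 1
  have h1 : e '' (O ∩ e.source) ∈ 𝓝 (e 1) :=
    e.image_mem_nhds he1 (Filter.inter_mem hO (e.open_source.mem_nhds he1))
  obtain ⟨V, hV, hVc, hVO⟩ := locallyConnectedSpace_iff_connected_subsets.1 ‹_› (e 1) _ h1
  have hVt : V ⊆ e.target := fun v hv => by
    obtain ⟨x, hx, rfl⟩ := hVO hv
    exact e.map_source hx.2
  refine ⟨e.symm '' V, ?_, hVc.image _ (e.symm.continuousOn.mono hVt), ?_⟩
  · rintro _ ⟨v, hv, rfl⟩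
    obtain ⟨x, hx, rfl⟩ := hVO hv
    rw [e.left_inv hx.2]
    exact hx.1
  · have h2 := e.symm.image_mem_nhds (e.map_source he1) hV
    rwa [e.left_inv he1] at h2

/-- Near the identity, the matrices acting like elements of `G` do not all fix a common line:
otherwise the group would be solvable. -/
theorem exists_conj_apply_ne_zero (r : SL(2, ℝ)) {O : Set (actionPairs G SL(2, ℝ) ℍ)}
    (hO : O ∈ 𝓝 1) : ∃ q ∈ O, (r * pairSnd G q * r⁻¹) 0 1 ≠ 0 := by
  by_contra! hcon
  let φ : SL(2, ℝ) →* SL(2, ℝ) := (MulAut.conj r).toMonoidHom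
  let S := (lowerTriangular.comap φ).comap (pairSnd G)
  have hSo : IsOpen (S : Set (actionPairs G SL(2, ℝ) ℍ)) :=
    S.isOpen_of_mem_nhds (g := 1) (Filter.mem_of_superset hO hcon)
  have hconn := hG.1
  have hSG : (S.map (pairFst G) : Set G) = Set.univ := by
    have ho : IsOpen (S.map (pairFst G) : Set G) := hA.isOpenMap_pairFst hG _ hSo
    exact IsClopen.eq_univ ⟨Subgroup.isClosed_of_isOpen _ ho, ho⟩ ⟨1, one_mem (S.map (pairFst G))⟩
  have h1 : ∀ g, ∃ B ∈ lowerTriangular.comap φ, (g, B) ∈ actionPairs G SL(2, ℝ) ℍ := by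
    intro g
    obtain ⟨q, hq, rfl⟩ : g ∈ (S.map (pairFst G) : Set G) := hSG ▸ Set.mem_univ g
    exact ⟨pairSnd G q, hq, q.2⟩
  have h2 := exists_mem_of_commutator_le hG.commutator_eq_top _ h1
    (T' := lowerUnipotent.comap φ) fun a ha b hb => by
      rw [Subgroup.mem_comap, map_commutatorElement]
      exact commutator_mem_lowerUnipotent ha hb
  have h3 := exists_mem_of_commutator_le hG.commutator_eq_top _ h2
    (T' := ⊥) fun a ha b hb => by
      rw [Subgroup.mem_bot]
      apply (MulAut.conj r).injective
      have := map_commutatorElement φ a b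
      rw [map_one]
      exact this.trans (commutator_eq_one_of_mem_lowerUnipotent ha hb)
  obtain ⟨g, hg⟩ := hA.exists_smul_eq I ⟨⟨0, 2⟩, by norm_num⟩
  obtain ⟨B, hB, hgB⟩ := h3 g
  rw [Subgroup.mem_bot] at hB
  subst hB
  have h4 : g • I = I := by simpa using hgB I
  rw [h4] at hg
  have h5 : (1 : ℝ) = 2 := congrArg UpperHalfPlane.im hg
  norm_num at h5

end IsProperIsometricAction
end Projections
/-! ### Generators of `SL(2, ℝ)` -/

section Generation

/-- The unipotent upper triangular matrix with entry `s`. -/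
def sl2Upper (s : ℝ) : SL(2, ℝ) := sl2Mk 1 s 0 1 (by ring)

/-- The unipotent lower triangular matrix with entry `s`. -/
def sl2Lower (s : ℝ) : SL(2, ℝ) := sl2Mk 1 0 s 1 (by ring)

/-- `SL(2, ℝ)` is generated by its unipotent triangular matrices. -/
theorem eq_top_of_upper_lower_mem {R : Subgroup SL(2, ℝ)} (hu : ∀ s, sl2Upper s ∈ R)
    (hl : ∀ s, sl2Lower s ∈ R) : R = ⊤ := by
  have h1 : ∀ B : SL(2, ℝ), B 1 0 ≠ 0 → B ∈ R := by
    intro B hc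
    have hdet := det_eq B
    have : B = sl2Upper ((B 0 0 - 1) / B 1 0) * sl2Lower (B 1 0) *
        sl2Upper ((B 1 1 - 1) / B 1 0) := by
      apply sl2_ext <;> simp only [sl2_mul_apply, sl2Upper, sl2Lower, sl2Mk_00, sl2Mk_01,
        sl2Mk_10, sl2Mk_11] <;> field_simp
      · ring
      · linear_combination -hdet
      · ring
      · ring
    rw [this]
    exact R.mul_mem (R.mul_mem (hu _) (hl _)) (hu _)
  rw [eq_top_iff]
  intro B _
  by_cases hc : B 1 0 = 0
  · have hdet := det_eq B
    have h2 : B * sl2Lower 1 ∈ R := by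
      apply h1
      simp only [sl2_mul_apply, sl2Lower, sl2Mk_00, sl2Mk_10, hc]
      intro h
      have h3 : B 1 1 = 0 := by linarith
      simp [h3, hc] at hdet
    have := R.mul_mem h2 (R.inv_mem (hl 1))
    rwa [mul_inv_cancel_right] at this
  · exact h1 B hc

/-- Besides the unipotent upper triangular matrices, one matrix that is not upper triangular
suffices to generate `SL(2, ℝ)`. -/
theorem eq_top_of_upper_mem {R : Subgroup SL(2, ℝ)} (hu : ∀ s, sl2Upper s ∈ R)
    {B : SL(2, ℝ)} (hB : B ∈ R) (hc : B 1 0 ≠ 0) : R = ⊤ := by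
  -- such a matrix gives a matrix with zero diagonal, which conjugates upper to lower triangular
  -- matrices
  refine eq_top_of_upper_lower_mem hu fun s => ?_
  have hdet := det_eq B
  have h1 : (sl2Upper (-(B 0 0 / B 1 0)) * B * sl2Upper (-(B 1 1 / B 1 0))) ∈ R :=
    R.mul_mem (R.mul_mem (hu _) hB) (hu _)
  have h2 : (sl2Upper (-(B 0 0 / B 1 0)) * B * sl2Upper (-(B 1 1 / B 1 0))) =
      sl2Mk 0 (-(1 / B 1 0)) (B 1 0) 0 (by field_simp; ring) := by
    apply sl2_ext <;> simp only [sl2_mul_apply, sl2Upper, sl2Mk_00, sl2Mk_01,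
        sl2Mk_10, sl2Mk_11] <;> field_simp
    · ring
    · linear_combination -hdet
    · ring
    · ring
  rw [h2] at h1
  have h3 := R.mul_mem (R.mul_mem h1 (hu (-(s / B 1 0 ^ 2)))) (R.inv_mem h1)
  convert h3 using 1
  apply sl2_ext <;> simp only [sl2_mul_apply, sl2_inv_apply, sl2Upper, sl2Lower, sl2Mk_00,
    sl2Mk_01, sl2Mk_10, sl2Mk_11] <;> field_simp <;> ring

end Generation

/-! ### Surjectivity onto `SL(2, ℝ)` -/

section Surjective

open UpperHalfPlane Topology

variable {G : Type*} [Group G] [TopologicalSpace G] [IsTopologicalGroup G] [MulAction G ℍ]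

namespace IsProperIsometricAction

variable (hA : IsProperIsometricAction G) (hG : IsSimpleLie G)
include hA hG

/-- The matrices acting like elements of `G` contain sequences `aₙ rₙ` where `aₙ` is the diagonal
matrix with entries `n + 1` and `1 / (n + 1)`, and `rₙ` converges. -/
theorem exists_tendsto_diagonal_mul : ∃ (r : SL(2, ℝ)) (ρ : ℕ → SL(2, ℝ)) (l : Filter ℕ),
    l.NeBot ∧ l ≤ Filter.atTop ∧ Filter.Tendsto ρ l (𝓝 r) ∧
    ∀ n : ℕ, sl2Mk (n + 1) 0 0 (n + 1)⁻¹ (by field_simp; ring) * ρ n ∈ (pairSnd G).range := by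
  let a : ℕ → SL(2, ℝ) := fun n => sl2Mk (n + 1) 0 0 (n + 1)⁻¹ (by field_simp; ring)
  choose g hg using fun n => hA.exists_smul_eq I (a n • I)
  choose B hB using fun n => hA.exists_SL2 hG (g n)
  have h1 : ∀ n, (a n)⁻¹ * B n ∈ {B : SL(2, ℝ) | B • I ∈ ({I} : Set ℍ)} := by
    intro n
    simp only [Set.mem_ofPred_eq, Set.mem_singleton_iff]
    rw [mul_smul, inv_smul_eq_iff, ← hg n]
    exact (hB n I).symm
  let 𝒰 := (Filter.hyperfilter ℕ).map fun n => (a n)⁻¹ * B n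
  obtain ⟨r, -, hr⟩ :=
    (isCompact_setOf_smul_I_mem (isCompact_singleton (x := I))).ultrafilter_le_nhds 𝒰
      (Filter.le_principal_iff.2 (Filter.mem_map.2 (Filter.univ_mem' h1)))
  refine ⟨r, fun n => (a n)⁻¹ * B n, Filter.hyperfilter ℕ, inferInstance,
    Nat.hyperfilter_le_atTop, hr, fun n => ?_⟩
  change a n * ((a n)⁻¹ * B n) ∈ _
  rw [mul_inv_cancel_left]
  exact ⟨⟨(g n, B n), hB n⟩, rfl⟩

variable [T2Space G] [LocallyCompactSpace G] [LocallyConnectedSpace G]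

/-- The closed group of matrices acting like elements of `G` contains the unipotent upper triangular
matrices. With `aₙ rₙ` as in `exists_tendsto_diagonal_mul`, it contains the conjugates by `aₙ` of
`rₙ h rₙ⁻¹` for its small elements `h`. Conjugation by `aₙ` multiplies the upper right entry by
`(n + 1) ^ 2` and the lower left one by `(n + 1) ^ (-2)`, so `h` can be chosen such that the
conjugate is close to the given unipotent matrix. -/
theorem sl2Upper_mem_range (s : ℝ) : sl2Upper s ∈ (pairSnd G).range := by
  rw [← SetLike.mem_coe, ← hA.isClosed_range_pairSnd.closure_eq, mem_closure_iff_nhds]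
  intro W hW
  have hind : Topology.IsInducing (fun B : SL(2, ℝ) => B.val) :=
    Matrix.SpecialLinearGroup.isClosedEmbedding_val.isInducing
  rw [hind.nhds_eq_comap, Filter.mem_comap] at hW
  obtain ⟨W', hW', hWW'⟩ := hW
  -- `Φ (M, (n + 1) ^ (-2))` is the conjugate of `M` by `aₙ` if its upper right entry is `s`
  let Φ : Matrix (Fin 2) (Fin 2) ℝ × ℝ → Matrix (Fin 2) (Fin 2) ℝ :=
    fun p => !![p.1 0 0, s; p.2 * p.1 1 0, p.1 1 1]
  have hΦ : Continuous Φ := by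
    refine continuous_matrix fun i j => ?_
    fin_cases i <;> fin_cases j <;> simp [Φ] <;> fun_prop
  have hΦ1 : Φ (1, 0) = (sl2Upper s).val := by simp [Φ, sl2Upper]
  have h1 : Φ ⁻¹' W' ∈ 𝓝 ((1, 0) : Matrix (Fin 2) (Fin 2) ℝ × ℝ) :=
    hΦ.continuousAt.preimage_mem_nhds (by rwa [hΦ1])
  rw [nhds_prod_eq, Filter.mem_prod_iff] at h1
  obtain ⟨N₁, hN₁, N₂, hN₂, hN⟩ := h1
  let Ψ : SL(2, ℝ) × actionPairs G SL(2, ℝ) ℍ → Matrix (Fin 2) (Fin 2) ℝ :=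
    fun p => (p.1 * pairSnd G p.2 * p.1⁻¹).val
  have hΨ : Continuous Ψ := by
    exact hind.continuous.comp
      ((continuous_fst.mul (continuous_pairSnd.comp continuous_snd)).mul continuous_fst.inv)
  have hΨ1 : ∀ r, Ψ (r, 1) = 1 := fun r => by
    change (r * pairSnd G 1 * r⁻¹).val = 1
    rw [map_one, mul_one, mul_inv_cancel, Matrix.SpecialLinearGroup.coe_one]
  obtain ⟨r, ρ, l, hl, hltop, hρ, hR⟩ := hA.exists_tendsto_diagonal_mul hG
  have h2 : Ψ ⁻¹' N₁ ∈ 𝓝 ((r, 1) : SL(2, ℝ) × actionPairs G SL(2, ℝ) ℍ) :=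
    hΨ.continuousAt.preimage_mem_nhds (by rwa [hΨ1])
  rw [nhds_prod_eq, Filter.mem_prod_iff] at h2
  obtain ⟨Nr, hNr, O, hO, hNO⟩ := h2
  -- the connected set `U` is also small after inversion, which changes the sign of the upper right
  -- entry
  obtain ⟨U, hUO, hUc, hU1⟩ := hA.exists_isPreconnected_nhds hG
    (Filter.inter_mem hO (inv_mem_nhds_one _ hO))
  obtain ⟨h₀, hh₀, hβ⟩ := hA.exists_conj_apply_ne_zero hG r hU1
  have hcont : ∀ q, Continuous fun r' : SL(2, ℝ) => (r' * pairSnd G q * r'⁻¹) 0 1 := by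
    intro q
    have : Continuous fun r' : SL(2, ℝ) => Ψ (r', q) := by fun_prop
    exact this.matrix_elem 0 1
  set β := (r * pairSnd G h₀ * r⁻¹) 0 1 with hβd
  have e1 : ∀ᶠ n in l, |β| / 2 < |(ρ n * pairSnd G h₀ * (ρ n)⁻¹) 0 1| :=
    (((hcont h₀).tendsto r).comp hρ).abs.eventually_const_lt
      (half_lt_self (abs_pos.2 hβ))
  have e0 : Filter.Tendsto (fun n : ℕ => ((n : ℝ) + 1)⁻¹ * ((n : ℝ) + 1)⁻¹) l (𝓝 0) := by
    have := (tendsto_one_div_add_atTop_nhds_zero_nat (𝕜 := ℝ)).mono_left hltop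
    simpa using this.mul this
  have e2 := e0.eventually hN₂
  have e3 : ∀ᶠ n : ℕ in l, |s * (((n : ℝ) + 1)⁻¹ * ((n : ℝ) + 1)⁻¹)| < |β| / 2 := by
    have := (e0.const_mul s).abs
    rw [mul_zero, abs_zero] at this
    exact this.eventually_lt_const (half_pos (abs_pos.2 hβ))
  obtain ⟨n, he1, he2, he3, he4⟩ := (e1.and (e2.and (e3.and (hρ.eventually hNr)))).exists
  set ε := s * (((n : ℝ) + 1)⁻¹ * ((n : ℝ) + 1)⁻¹) with hε
  let φ : actionPairs G SL(2, ℝ) ℍ → ℝ := fun q => (ρ n * pairSnd G q * (ρ n)⁻¹) 0 1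
  have hφ : Continuous φ := by
    have : Continuous fun q => Ψ (ρ n, q) := by fun_prop
    exact this.matrix_elem 0 1
  have hφinv : ∀ q, φ q⁻¹ = -φ q := by
    intro q
    have : ρ n * pairSnd G q⁻¹ * (ρ n)⁻¹ = (ρ n * pairSnd G q * (ρ n)⁻¹)⁻¹ := by
      rw [map_inv]; group
    simp only [φ, this]
    exact (sl2_inv_apply _).2.1
  have hφ1 : φ 1 = 0 := (congrFun₂ (hΨ1 (ρ n)) 0 1).trans (by simp)
  have huIcc : Set.uIcc 0 (φ h₀) ⊆ φ '' U := by
    have := (hUc.image φ hφ.continuousOn).ordConnected.uIcc_subset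
      ⟨1, mem_of_mem_nhds hU1, rfl⟩ ⟨h₀, hh₀, rfl⟩
    rwa [hφ1] at this
  have hεφ : |ε| < |φ h₀| := he3.trans he1
  -- by the intermediate value theorem, `φ` takes the value `ε` or `-ε` on `U`
  obtain ⟨h, hhO, hφh⟩ : ∃ h ∈ O, φ h = ε := by
    have : ε ∈ Set.uIcc 0 (φ h₀) ∨ -ε ∈ Set.uIcc 0 (φ h₀) := by
      simp only [Set.mem_uIcc]
      rcases abs_cases ε with h | h <;> rcases abs_cases (φ h₀) with h' | h' <;> grind
    rcases this with h | h
    · obtain ⟨q, hq, hq'⟩ := huIcc h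
      exact ⟨q, (hUO hq).1, hq'⟩
    · obtain ⟨q, hq, hq'⟩ := huIcc h
      exact ⟨q⁻¹, (hUO hq).2, by rw [hφinv, hq', neg_neg]⟩
  set M := ρ n * pairSnd G h * (ρ n)⁻¹ with hM
  have hM1 : M.val ∈ N₁ := hNO (a := (ρ n, h)) ⟨he4, hhO⟩
  set a := sl2Mk ((n : ℝ) + 1) 0 0 ((n : ℝ) + 1)⁻¹ (by field_simp; ring) with ha
  refine ⟨(a * ρ n) * pairSnd G h * (a * ρ n)⁻¹, hWW' ?_,
    (pairSnd G).range.mul_mem ((pairSnd G).range.mul_mem (hR n) ⟨h, rfl⟩)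
      ((pairSnd G).range.inv_mem (hR n))⟩
  have h3 : (a * ρ n) * pairSnd G h * (a * ρ n)⁻¹ = a * M * a⁻¹ := by rw [hM]; group
  have h4 : (a * M * a⁻¹).val = Φ (M.val, ((n : ℝ) + 1)⁻¹ * ((n : ℝ) + 1)⁻¹) := by
    have hM01 : M 0 1 = ε := hφh
    ext i j
    fin_cases i <;> fin_cases j
    · change (a * M * a⁻¹) 0 0 = M 0 0
      simp [sl2_mul_apply, sl2_inv_apply, ha]; field_simp
    · change (a * M * a⁻¹) 0 1 = s
      simp [sl2_mul_apply, sl2_inv_apply, ha, hM01, hε]; field_simp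
    · change (a * M * a⁻¹) 1 0 = ((n : ℝ) + 1)⁻¹ * ((n : ℝ) + 1)⁻¹ * M 1 0
      simp [sl2_mul_apply, sl2_inv_apply, ha]; ring
    · change (a * M * a⁻¹) 1 1 = M 1 1
      simp [sl2_mul_apply, sl2_inv_apply, ha]; field_simp
  rw [Set.mem_preimage, h3, h4]
  exact hN ⟨hM1, he2⟩

theorem surjective_pairSnd : Function.Surjective (pairSnd G) := by
  rw [← MonoidHom.range_eq_top]
  obtain ⟨q, -, hq⟩ := hA.exists_conj_apply_ne_zero hG (sl2Mk 0 (-1) 1 0 (by norm_num))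
    (O := Set.univ) Filter.univ_mem
  refine eq_top_of_upper_mem (hA.sl2Upper_mem_range hG) (B := pairSnd G q) ⟨q, rfl⟩ ?_
  intro h
  simp [sl2_mul_apply, sl2_inv_apply, h] at hq

theorem isOpenMap_pairSnd : IsOpenMap (pairSnd G) :=
  have := hA.sigmaCompactSpace_actionPairs
  MonoidHom.isOpenMap_of_sigmaCompact _ (hA.surjective_pairSnd hG) continuous_pairSnd

end IsProperIsometricAction
end Surjective
/-! ### The covering of `PGL(d, ℝ)` by unimodular matrices -/

section Unimodular

open Topology

variable {d : ℕ}

/-- The invertible matrices of determinant `1` or `-1`. -/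
def unimodular (d : ℕ) : Subgroup (GL (Fin d) ℝ) where
  carrier := {A | |A.val.det| = 1}
  one_mem' := by simp
  mul_mem' := by
    intro A B hA hB
    simp only [Set.mem_ofPred_eq] at hA hB ⊢
    rw [Units.val_mul, Matrix.det_mul, abs_mul, hA, hB, one_mul]
  inv_mem' := by
    intro A hA
    simp only [Set.mem_ofPred_eq] at hA ⊢
    have h : |A⁻¹.val.det| * |A.val.det| = 1 := by
      rw [← abs_mul, ← Matrix.det_mul, ← Units.val_mul, inv_mul_cancel, Units.val_one,
        Matrix.det_one, abs_one]
    rwa [hA, mul_one] at h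

theorem abs_det_mul_scalar (A : GL (Fin d) ℝ) (u : ℝˣ) :
    |(A * Matrix.GeneralLinearGroup.scalar (Fin d) u).val.det| = |A.val.det| * |u.val| ^ d := by
  rw [Units.val_mul, Matrix.det_mul, abs_mul]
  simp [Matrix.det_diagonal]

/-- The projection of `unimodular d` to `PGL(d, ℝ)`. -/
def unimodularToPGL (d : ℕ) : unimodular d →* PGL(d, ℝ) :=
  Matrix.ProjGenLinGroup.mk.comp (unimodular d).subtype

/-- Unimodular representatives of an element of `PGL(d, ℝ)` are unique up to sign. -/
theorem eq_or_eq_mul_scalar_neg_one {A B : GL (Fin d) ℝ} (hA : |A.val.det| = 1)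
    (hB : |B.val.det| = 1) (h : Matrix.ProjGenLinGroup.mk A = Matrix.ProjGenLinGroup.mk B) :
    B = A ∨ B = A * Matrix.GeneralLinearGroup.scalar (Fin d) (-1) := by
  rcases Nat.eq_zero_or_pos d with rfl | hd
  · exact Or.inl (Units.ext (Subsingleton.elim _ _))
  obtain ⟨u, rfl⟩ := Matrix.ProjGenLinGroup.mk_eq_mk_iff.1 h
  rw [abs_det_mul_scalar, hA, one_mul, pow_eq_one_iff_of_nonneg (abs_nonneg _) hd.ne'] at hB
  rcases eq_or_eq_neg_of_abs_eq hB with h1 | h1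
  · left
    rw [Units.ext (u := u) (v := 1) h1, map_one, mul_one]
  · right
    rw [Units.ext (u := u) (v := -1) h1]

/-- The positive scalar which makes `A` unimodular. In dimension `0` the exponent is `1 / 0 = 0`,
and the scalar is `1`. -/
noncomputable def normalizer (A : GL (Fin d) ℝ) : ℝˣ :=
  Units.mk0 (|A.val.det| ^ (-(1 / d : ℝ)))
    (Real.rpow_pos_of_pos (abs_pos.2 ((Matrix.isUnit_iff_isUnit_det _).1 A.isUnit).ne_zero) _).ne'

theorem mul_scalar_normalizer_mem (A : GL (Fin d) ℝ) :
    A * Matrix.GeneralLinearGroup.scalar (Fin d) (normalizer A) ∈ unimodular d := by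
  change |_| = 1
  have hpos : 0 < |A.val.det| := abs_pos.2 ((Matrix.isUnit_iff_isUnit_det _).1 A.isUnit).ne_zero
  rw [abs_det_mul_scalar, normalizer, Units.val_mk0, abs_of_pos (Real.rpow_pos_of_pos hpos _)]
  rcases Nat.eq_zero_or_pos d with rfl | hd
  · simp
  · have hd' : (d : ℝ) ≠ 0 := by positivity
    rw [← Real.rpow_natCast, ← Real.rpow_mul hpos.le, neg_mul, one_div_mul_cancel hd',
      Real.rpow_neg_one, mul_inv_cancel₀ hpos.ne']

theorem continuous_scalar : Continuous (Matrix.GeneralLinearGroup.scalar (Fin d) : ℝˣ → _) := by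
  rw [Units.continuous_iff]
  constructor
  · refine continuous_matrix fun i j => ?_
    by_cases h : i = j
    · subst h; simpa using Units.continuous_val
    · simpa [h] using continuous_const
  · have h : ∀ u : ℝˣ, (Matrix.GeneralLinearGroup.scalar (Fin d) u)⁻¹.val =
        Matrix.diagonal fun _ => (u⁻¹ : ℝˣ).val := fun u => by rw [← map_inv]; rfl
    refine continuous_matrix fun i j => ?_
    simp only [h]
    by_cases hij : i = j
    · subst hij
      simp only [Matrix.diagonal_apply_eq]
      exact Units.continuous_val.comp continuous_inv
    · simpa [hij] using continuous_const

theorem continuous_normalizer : Continuous (normalizer : GL (Fin d) ℝ → ℝˣ) := by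
  have h0 : ∀ A : GL (Fin d) ℝ, |A.val.det| ≠ 0 := fun A =>
    abs_ne_zero.2 ((Matrix.isUnit_iff_isUnit_det _).1 A.isUnit).ne_zero
  have h1 : Continuous fun A : GL (Fin d) ℝ => |A.val.det| ^ (-(1 / d : ℝ)) :=
    (Units.continuous_val.matrix_det.abs).rpow_const fun A => Or.inl (h0 A)
  rw [Units.continuous_iff]
  refine ⟨h1, ?_⟩
  simp only [normalizer, Units.val_inv_eq_inv_val, Units.val_mk0]
  exact h1.inv₀ fun A => (Real.rpow_pos_of_pos (abs_pos.2 (abs_ne_zero.1 (h0 A))) _).ne'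

theorem continuous_unimodularToPGL : Continuous (unimodularToPGL d) :=
  continuous_coinduced_rng.comp continuous_subtype_val

theorem mk_mul_scalar (A : GL (Fin d) ℝ) (u : ℝˣ) :
    Matrix.ProjGenLinGroup.mk (A * Matrix.GeneralLinearGroup.scalar (Fin d) u) =
      Matrix.ProjGenLinGroup.mk A := by
  rw [map_mul, Matrix.ProjGenLinGroup.mk_scalar, mul_one]

theorem surjective_unimodularToPGL : Function.Surjective (unimodularToPGL d) := fun g => by
  obtain ⟨A, rfl⟩ := Matrix.ProjGenLinGroup.mk_surjective g
  exact ⟨⟨_, mul_scalar_normalizer_mem A⟩, mk_mul_scalar A _⟩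

theorem scalar_neg_one_mem : Matrix.GeneralLinearGroup.scalar (Fin d) (-1) ∈ unimodular d := by
  change |_| = 1
  rw [← one_mul (Matrix.GeneralLinearGroup.scalar (Fin d) (-1)), abs_det_mul_scalar]
  simp

theorem finite_ker_unimodularToPGL : ((unimodularToPGL d).ker : Set (unimodular d)).Finite := by
  refine (Set.toFinite {1, ⟨_, scalar_neg_one_mem⟩}).subset ?_
  rintro ⟨A, hA⟩ hA1
  have h1 : Matrix.ProjGenLinGroup.mk 1 = Matrix.ProjGenLinGroup.mk A :=
    (MonoidHom.mem_ker.1 hA1).symm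
  rcases eq_or_eq_mul_scalar_neg_one (by simp) hA h1 with h | h
  · exact Or.inl (Subtype.ext h)
  · rw [one_mul] at h
    exact Or.inr (Subtype.ext h)

/-- The preimage in `GL(d, ℝ)` of the image of `W` consists of the matrices whose normalization
is in `W` up to sign. -/
theorem isOpenMap_unimodularToPGL : IsOpenMap (unimodularToPGL d) := by
  intro W hW
  let ν : GL (Fin d) ℝ → unimodular d := fun A => ⟨_, mul_scalar_normalizer_mem A⟩
  have hν : Continuous ν := Continuous.subtype_mk
    (continuous_id.mul (continuous_scalar.comp continuous_normalizer)) _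
  have hmk : ∀ A, Matrix.ProjGenLinGroup.mk (ν A).val = Matrix.ProjGenLinGroup.mk A :=
    fun A => mk_mul_scalar A _
  rw [isOpen_coinduced]
  have : (Matrix.ProjGenLinGroup.mk : GL (Fin d) ℝ → PGL(d, ℝ)) ⁻¹' (unimodularToPGL d '' W) =
      ν ⁻¹' W ∪ (fun A => ν A * ⟨_, scalar_neg_one_mem⟩) ⁻¹' W := by
    ext A
    constructor
    · rintro ⟨B, hB, hBA⟩
      have h1 : Matrix.ProjGenLinGroup.mk (ν A).val = Matrix.ProjGenLinGroup.mk B.val :=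
        (hmk A).trans hBA.symm
      rcases eq_or_eq_mul_scalar_neg_one (ν A).2 B.2 h1 with h | h
      · exact Or.inl (by rwa [Set.mem_preimage, ← Subtype.ext h])
      · refine Or.inr ?_
        have h2 : B = ν A * ⟨_, scalar_neg_one_mem⟩ := Subtype.ext h
        rwa [Set.mem_preimage, ← h2]
    · rintro (h | h)
      · exact ⟨_, h, hmk A⟩
      · exact ⟨_, h, (mk_mul_scalar _ _).trans (hmk A)⟩
  rw [this]
  exact (hW.preimage hν).union (hW.preimage (hν.mul continuous_const))

end Unimodular
/-! ### Commutation relations from relations between exponentials -/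

section Derivatives

open scoped Matrix.Norms.Operator

variable {d : ℕ}

theorem hasDerivAt_exp_comp_smul (X : Matrix (Fin d) (Fin d) ℝ) {φ : ℝ → ℝ} {φ' t : ℝ}
    (hφ : HasDerivAt φ φ' t) :
    HasDerivAt (fun u => NormedSpace.exp (φ u • X)) (φ' • (NormedSpace.exp (φ t • X) * X)) t :=
  (hasDerivAt_exp_smul_const (𝕂 := ℝ) X (φ t)).scomp t hφ

/-- Conjugation relations between one-parameter groups give commutation relations between their
generators. -/
theorem mul_eq_of_exp_conj {H E : Matrix (Fin d) (Fin d) ℝ} {c : ℝ}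
    (h : ∀ t s : ℝ, NormedSpace.exp (t • H) * NormedSpace.exp (s • E) =
      NormedSpace.exp ((Real.exp (c * t) * s) • E) * NormedSpace.exp (t • H)) :
    H * E = E * H + c • E := by
  -- the derivative at `s = 0`
  have h1 : ∀ t : ℝ, NormedSpace.exp (t • H) * E =
      Real.exp (c * t) • (E * NormedSpace.exp (t • H)) := by
    intro t
    have e1 := (hasDerivAt_exp_comp_smul E (hasDerivAt_id (0 : ℝ))).const_mul
      (NormedSpace.exp (t • H))
    have e2 := (hasDerivAt_exp_comp_smul E ((hasDerivAt_id (0 : ℝ)).const_mul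
      (Real.exp (c * t)))).mul_const (NormedSpace.exp (t • H))
    simp only [id, h] at e1 e2
    simpa using e1.unique e2
  -- the derivative at `t = 0`
  have e1 := (hasDerivAt_exp_comp_smul H (hasDerivAt_id (0 : ℝ))).mul_const E
  have e2 := (((hasDerivAt_id (0 : ℝ)).const_mul c).exp).smul
    ((hasDerivAt_exp_comp_smul H (hasDerivAt_id (0 : ℝ))).const_mul E)
  simp only [id, h1] at e1
  have := e1.unique e2
  simpa using this

/-- The third commutation relation is the mixed second derivative at `s = r = 0` of the formula for
a product of an upper and a lower unipotent matrix. -/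
theorem mul_eq_of_exp_mul_exp {E F H : Matrix (Fin d) (Fin d) ℝ}
    (h : ∀ s r : ℝ, 0 < 1 + r * s → NormedSpace.exp (s • E) * NormedSpace.exp (r • F) =
      NormedSpace.exp ((r / (1 + r * s)) • F) * NormedSpace.exp (Real.log (1 + r * s) • H) *
        NormedSpace.exp ((s / (1 + r * s)) • E)) :
    E * F = F * E + H := by
  -- the derivative at `r = 0`
  have h1 : ∀ s : ℝ, NormedSpace.exp (s • E) * F = F * NormedSpace.exp (s • E) +
      s • (H * NormedSpace.exp (s • E)) - s ^ 2 • (NormedSpace.exp (s • E) * E) := by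
    intro s
    have d0 : HasDerivAt (fun r : ℝ => 1 + r * s) s 0 := by
      simpa using ((hasDerivAt_id (0 : ℝ)).mul_const s).const_add 1
    have e1 := (hasDerivAt_exp_comp_smul F (hasDerivAt_id (0 : ℝ))).const_mul
      (NormedSpace.exp (s • E))
    have e2 := ((hasDerivAt_exp_comp_smul F ((hasDerivAt_id (0 : ℝ)).div d0 (by simp))).mul
      (hasDerivAt_exp_comp_smul H (d0.log (by simp)))).mul
      (hasDerivAt_exp_comp_smul E ((hasDerivAt_const (0 : ℝ) s).div d0 (by simp)))
    have hev : ∀ᶠ r : ℝ in nhds 0, 0 < 1 + r * s :=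
      d0.continuousAt.eventually_const_lt (by simp)
    have e3 := e1.congr_of_eventuallyEq (f₁ := fun r =>
      NormedSpace.exp ((r / (1 + r * s)) • F) * NormedSpace.exp (Real.log (1 + r * s) • H) *
        NormedSpace.exp ((s / (1 + r * s)) • E)) (hev.mono fun r hr => (h s r hr).symm)
    have := e3.unique e2
    simp at this
    rw [this]
    simp only [add_mul, smul_mul_assoc, pow_two]
    abel
  -- the derivative at `s = 0`
  have e1 := (hasDerivAt_exp_comp_smul E (hasDerivAt_id (0 : ℝ))).mul_const F
  have e2 := (((hasDerivAt_exp_comp_smul E (hasDerivAt_id (0 : ℝ))).const_mul F).add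
    ((hasDerivAt_id (0 : ℝ)).smul
      ((hasDerivAt_exp_comp_smul E (hasDerivAt_id (0 : ℝ))).const_mul H))).sub
    (((hasDerivAt_id (0 : ℝ)).pow 2).smul
      ((hasDerivAt_exp_comp_smul E (hasDerivAt_id (0 : ℝ))).mul_const E))
  have := (e1.congr_of_eventuallyEq (Filter.Eventually.of_forall fun s => (h1 s).symm)).unique e2
  simpa using this

end Derivatives
/-! ### Representations of coverings of `SL(2, ℝ)` -/

section Relations

/-- The diagonal matrix with entries `exp t` and `exp (-t)`. -/
noncomputable def sl2Diag (t : ℝ) : SL(2, ℝ) :=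
  sl2Mk (Real.exp t) 0 0 (Real.exp (-t)) (by rw [← Real.exp_add]; simp)

theorem continuous_sl2Mk {X : Type*} [TopologicalSpace X] {a b c d : X → ℝ} (ha : Continuous a)
    (hb : Continuous b) (hc : Continuous c) (hd : Continuous d)
    (h : ∀ x, a x * d x - b x * c x = 1) :
    Continuous fun x => sl2Mk (a x) (b x) (c x) (d x) (h x) := by
  have hind : Topology.IsInducing (fun B : SL(2, ℝ) => B.val) :=
    Matrix.SpecialLinearGroup.isClosedEmbedding_val.isInducing
  rw [hind.continuous_iff]
  refine continuous_matrix fun i j => ?_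
  fin_cases i <;> fin_cases j <;> simpa

theorem continuous_sl2Upper : Continuous sl2Upper :=
  continuous_sl2Mk continuous_const continuous_id continuous_const continuous_const _

theorem continuous_sl2Lower : Continuous sl2Lower :=
  continuous_sl2Mk continuous_const continuous_const continuous_id continuous_const _

theorem continuous_sl2Diag : Continuous sl2Diag :=
  continuous_sl2Mk Real.continuous_exp continuous_const continuous_const
    (Real.continuous_exp.comp continuous_neg) _

theorem sl2Upper_add (s t : ℝ) : sl2Upper (s + t) = sl2Upper s * sl2Upper t := by
  apply sl2_ext <;> simp only [sl2_mul_apply, sl2Upper, sl2Mk_00, sl2Mk_01, sl2Mk_10,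
    sl2Mk_11] <;> ring

theorem sl2Lower_add (s t : ℝ) : sl2Lower (s + t) = sl2Lower s * sl2Lower t := by
  apply sl2_ext <;> simp only [sl2_mul_apply, sl2Lower, sl2Mk_00, sl2Mk_01, sl2Mk_10,
    sl2Mk_11] <;> ring

theorem sl2Diag_add (s t : ℝ) : sl2Diag (s + t) = sl2Diag s * sl2Diag t := by
  apply sl2_ext <;> simp only [sl2_mul_apply, sl2Diag, sl2Mk_00, sl2Mk_01, sl2Mk_10,
    sl2Mk_11, neg_add, Real.exp_add] <;> ring

theorem sl2Diag_mul_sl2Upper (t s : ℝ) :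
    sl2Diag t * sl2Upper s = sl2Upper (Real.exp (2 * t) * s) * sl2Diag t := by
  have h : Real.exp (2 * t) = Real.exp t * Real.exp t := by rw [two_mul, Real.exp_add]
  apply sl2_ext <;> simp only [sl2_mul_apply, sl2Diag, sl2Upper, sl2Mk_00, sl2Mk_01, sl2Mk_10,
    sl2Mk_11, h, Real.exp_neg] <;> field_simp <;> ring

theorem sl2Diag_mul_sl2Lower (t s : ℝ) :
    sl2Diag t * sl2Lower s = sl2Lower (Real.exp (-2 * t) * s) * sl2Diag t := by
  have h : Real.exp (-2 * t) = (Real.exp t)⁻¹ * (Real.exp t)⁻¹ := by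
    rw [← Real.exp_neg, ← Real.exp_add]; ring_nf
  apply sl2_ext <;> simp only [sl2_mul_apply, sl2Diag, sl2Lower, sl2Mk_00, sl2Mk_01, sl2Mk_10,
    sl2Mk_11, h, Real.exp_neg] <;> field_simp <;> ring

/-- The decomposition into lower unipotent, diagonal and upper unipotent factors. -/
theorem sl2Upper_mul_sl2Lower {s r : ℝ} (h : 0 < 1 + r * s) :
    sl2Upper s * sl2Lower r =
      sl2Lower (r / (1 + r * s)) * sl2Diag (Real.log (1 + r * s)) * sl2Upper (s / (1 + r * s)) := by
  have hne := h.ne'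
  obtain ⟨k, hk⟩ : ∃ k, k = 1 + r * s := ⟨_, rfl⟩
  rw [← hk] at h hne ⊢
  apply sl2_ext <;> simp only [sl2_mul_apply, sl2Diag, sl2Lower, sl2Upper, sl2Mk_00, sl2Mk_01,
    sl2Mk_10, sl2Mk_11, Real.exp_neg, Real.exp_log h] <;> field_simp <;> subst hk <;> ring

variable {P : Type*} [Group P] [TopologicalSpace P] [IsTopologicalGroup P] [T2Space P] {d : ℕ}

/-- A continuous representation of a group covering `SL(2, ℝ)` with finite kernel is given on the
lifts of the unipotent matrices by exponentials satisfying the relations of `𝔰𝔩₂`. -/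
theorem exists_sl2Relations (f : P →* SL(2, ℝ)) (hker : (f.ker : Set P).Finite)
    (α : P →* GL (Fin d) ℝ) (hα : Continuous α) {U V D : ℝ → P}
    (hU : Continuous U) (hV : Continuous V) (hD : Continuous D)
    (hUm : ∀ s t, U (s + t) = U s * U t) (hVm : ∀ s t, V (s + t) = V s * V t)
    (hDm : ∀ s t, D (s + t) = D s * D t) (hfU : ∀ s, f (U s) = sl2Upper s)
    (hfV : ∀ s, f (V s) = sl2Lower s) (hfD : ∀ s, f (D s) = sl2Diag s) :
    ∃ E F H : Matrix (Fin d) (Fin d) ℝ, Sl2Relations E.mulVecLin F.mulVecLin H.mulVecLin ∧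
      (∀ s : ℝ, (α (U s)).val = NormedSpace.exp (s • E)) ∧
      (∀ s : ℝ, (α (V s)).val = NormedSpace.exp (s • F)) := by
  have hU0 : U 0 = 1 := by simpa using hUm 0 0
  have hV0 : V 0 = 1 := by simpa using hVm 0 0
  have hD0 : D 0 = 1 := by simpa using hDm 0 0
  obtain ⟨E, hE⟩ := exists_eq_exp_of_oneParameter_GL (fun s => α (U s)) (hα.comp hU)
    fun s t => by rw [hUm, map_mul]
  obtain ⟨F, hF⟩ := exists_eq_exp_of_oneParameter_GL (fun s => α (V s)) (hα.comp hV)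
    fun s t => by rw [hVm, map_mul]
  obtain ⟨H, hH⟩ := exists_eq_exp_of_oneParameter_GL (fun s => α (D s)) (hα.comp hD)
    fun s t => by rw [hDm, map_mul]
  have r1 : H * E = E * H + (2 : ℝ) • E := mul_eq_of_exp_conj fun t s => by
    have := eqOn_of_finite_ker f hker (s := Set.univ) isPreconnected_univ
      (x := fun s => D t * U s) (y := fun s => U (Real.exp (2 * t) * s) * D t) (by fun_prop)
      (by fun_prop) (fun s _ => by simp [hfU, hfD, sl2Diag_mul_sl2Upper]) (Set.mem_univ 0)
      (by simp [hU0]) (Set.mem_univ s)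
    rw [← hH, ← hE, ← hE, ← Units.val_mul, ← Units.val_mul, ← map_mul, ← map_mul]
    exact congrArg (fun q => (α q).val) this
  have r2 : H * F = F * H + (-2 : ℝ) • F := mul_eq_of_exp_conj fun t s => by
    have := eqOn_of_finite_ker f hker (s := Set.univ) isPreconnected_univ
      (x := fun s => D t * V s) (y := fun s => V (Real.exp (-2 * t) * s) * D t) (by fun_prop)
      (by fun_prop) (fun s _ => by simp only [map_mul, hfV, hfD, sl2Diag_mul_sl2Lower])
      (Set.mem_univ 0) (by simp [hV0]) (Set.mem_univ s)
    rw [← hH, ← hF, ← hF, ← Units.val_mul, ← Units.val_mul, ← map_mul, ← map_mul]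
    exact congrArg (fun q => (α q).val) this
  have r3 : E * F = F * E + H := mul_eq_of_exp_mul_exp fun s r hrs => by
    have hconv : Convex ℝ {r : ℝ | 0 < 1 + r * s} := by
      intro a ha b hb x y hx hy hxy
      simp only [Set.mem_ofPred_eq, smul_eq_mul] at ha hb ⊢
      have h1 : 1 + (x * a + y * b) * s = x * (1 + a * s) + y * (1 + b * s) := by
        linear_combination -hxy
      rw [h1]
      rcases hx.eq_or_lt with rfl | hx
      · rw [zero_add] at hxy
        rw [hxy]; linarith
      · have := mul_pos hx ha
        have := mul_nonneg hy hb.le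
        linarith
    have hne : ∀ r ∈ {r : ℝ | 0 < 1 + r * s}, 1 + r * s ≠ 0 := fun r hr => ne_of_gt hr
    have c1 : ContinuousOn (fun r : ℝ => 1 + r * s) {r : ℝ | 0 < 1 + r * s} := by fun_prop
    have := eqOn_of_finite_ker f hker hconv.isPreconnected
      (x := fun r => U s * V r) (y := fun r => V (r / (1 + r * s)) * D (Real.log (1 + r * s)) *
        U (s / (1 + r * s))) (by fun_prop)
      (((hV.comp_continuousOn (continuousOn_id.div c1 hne)).mul
        (hD.comp_continuousOn (c1.log hne))).mul
        (hU.comp_continuousOn (continuousOn_const.div c1 hne)))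
      (fun r hr => by simp only [map_mul, hfV, hfD, hfU]; exact sl2Upper_mul_sl2Lower hr)
      (a₀ := 0) (by simp) (by simp [hV0, hD0]) hrs
    rw [← hH, ← hE, ← hE, ← hF, ← hF, ← Units.val_mul, ← Units.val_mul, ← Units.val_mul,
      ← map_mul, ← map_mul, ← map_mul]
    exact congrArg (fun q => (α q).val) this
  refine ⟨E, F, H, ⟨fun x => ?_, fun x => ?_, fun x => ?_⟩, hE, hF⟩
  · simpa [Matrix.add_mulVec, Matrix.smul_mulVec] using congrArg (fun M => M *ᵥ x) r1
  · simpa [Matrix.add_mulVec, Matrix.smul_mulVec, Matrix.neg_mulVec, sub_eq_add_neg] using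
      congrArg (fun M => M *ᵥ x) r2
  · simpa [Matrix.add_mulVec] using congrArg (fun M => M *ᵥ x) r3

end Relations
/-! ### Projective representations of `G` -/

section Representation

open UpperHalfPlane Topology
open scoped commutatorElement

variable {G : Type*} [Group G] [MulAction G ℍ]

/-- The pairs of an element of `actionPairs` and a unimodular matrix representing its image under
`τ`. -/
noncomputable def liftedPairs {d : ℕ} (τ : G →* PGL(d, ℝ)) :
    Subgroup (actionPairs G SL(2, ℝ) ℍ × unimodular d) :=
  MonoidHom.eqLocus ((τ.comp (pairFst G)).comp (MonoidHom.fst _ _))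
    ((unimodularToPGL d).comp (MonoidHom.snd _ _))

theorem mem_liftedPairs {d : ℕ} {τ : G →* PGL(d, ℝ)}
    {p : actionPairs G SL(2, ℝ) ℍ × unimodular d} :
    p ∈ liftedPairs τ ↔ τ (pairFst G p.1) = unimodularToPGL d p.2 := Iff.rfl

/-- The projection of `liftedPairs τ` to `SL(2, ℝ)`. -/
noncomputable def liftedToSL {d : ℕ} (τ : G →* PGL(d, ℝ)) : liftedPairs τ →* SL(2, ℝ) :=
  ((pairSnd G).comp (MonoidHom.fst _ _)).comp (liftedPairs τ).subtype

/-- The projection of `liftedPairs τ` to `G`. -/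
noncomputable def liftedToG {d : ℕ} (τ : G →* PGL(d, ℝ)) : liftedPairs τ →* G :=
  ((pairFst G).comp (MonoidHom.fst _ _)).comp (liftedPairs τ).subtype

/-- The projection of `liftedPairs τ` to `GL(d, ℝ)`. -/
noncomputable def liftedToGL {d : ℕ} (τ : G →* PGL(d, ℝ)) : liftedPairs τ →* GL (Fin d) ℝ :=
  ((unimodular d).subtype.comp (MonoidHom.snd _ _)).comp (liftedPairs τ).subtype

theorem mk_liftedToGL {d : ℕ} (τ : G →* PGL(d, ℝ)) (q : liftedPairs τ) :
    Matrix.ProjGenLinGroup.mk (liftedToGL τ q) = τ (liftedToG τ q) :=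
  (mem_liftedPairs.1 q.2).symm

variable [TopologicalSpace G]

theorem continuous_liftedToGL {d : ℕ} (τ : G →* PGL(d, ℝ)) : Continuous (liftedToGL τ) :=
  continuous_subtype_val.comp (continuous_snd.comp continuous_subtype_val)

namespace IsProperIsometricAction

variable [IsTopologicalGroup G] (hA : IsProperIsometricAction G) (hG : IsSimpleLie G)
include hA hG

/-- The kernel maps to the finite kernel of `pairSnd`, and the fibers lie in cosets of the finite
kernel of `unimodularToPGL`. -/
theorem finite_ker_liftedToSL (hZ : Finite (Subgroup.center G)) {d : ℕ} (τ : G →* PGL(d, ℝ)) :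
    ((liftedToSL τ).ker : Set (liftedPairs τ)).Finite := by
  refine Set.Finite.of_finite_fibers (fun q => q.val.1)
    ((hA.finite_ker_pairSnd hG hZ).subset ?_) fun x _ => ?_
  · rintro _ ⟨q, hq, rfl⟩
    exact hq
  · refine Set.Finite.of_finite_image (f := fun q => q.val.2) ?_ ?_
    · rcases Set.eq_empty_or_nonempty
        (((liftedToSL τ).ker : Set (liftedPairs τ)) ∩ (fun q => q.val.1) ⁻¹' {x}) with h | ⟨q₀, hq₀⟩
      · rw [h, Set.image_empty]; exact Set.finite_empty
      · refine (finite_ker_unimodularToPGL.image fun A => q₀.val.2 * A).subset ?_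
        rintro _ ⟨q, hq, rfl⟩
        have h1 : q.val.1 = q₀.val.1 := hq.2.trans hq₀.2.symm
        refine ⟨(q₀.val.2)⁻¹ * q.val.2, ?_, mul_inv_cancel_left _ _⟩
        rw [SetLike.mem_coe, MonoidHom.mem_ker, map_mul, map_inv, ← mem_liftedPairs.1 q.2,
          ← mem_liftedPairs.1 q₀.2, h1, inv_mul_cancel]
    · intro q hq q' hq' h
      exact Subtype.ext (Prod.ext (hq.2.trans hq'.2.symm) h)

/-- A subgroup of `G` whose elements act as all of `SL(2, ℝ)` is `G`, because it generates `G`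
together with the center. -/
theorem map_liftedToG_eq_top {d : ℕ} {τ : G →* PGL(d, ℝ)} {T : Subgroup (liftedPairs τ)}
    (hT : T.map (liftedToSL τ) = ⊤) : T.map (liftedToG τ) = ⊤ := by
  have h1 : ∀ g : G, ∃ t ∈ T.map (liftedToG τ), ∃ n ∈ Subgroup.center G, g = t * n := by
    intro g
    obtain ⟨B, hB⟩ := hA.exists_SL2 hG g
    obtain ⟨t, ht, rfl⟩ : B ∈ T.map (liftedToSL τ) := hT ▸ Subgroup.mem_top B
    refine ⟨liftedToG τ t, ⟨t, ht, rfl⟩, (liftedToG τ t)⁻¹ * g, hA.mem_center hG fun z => ?_,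
      (mul_inv_cancel_left _ _).symm⟩
    rw [mul_smul, inv_smul_eq_iff]
    exact (hB z).trans (t.val.1.2 z).symm
  rw [eq_top_iff, ← hG.commutator_eq_top, commutator_def, Subgroup.commutator_le]
  intro a _ b _
  obtain ⟨s, hs, n, hn, rfl⟩ := h1 a
  obtain ⟨t, ht, k, hk, rfl⟩ := h1 b
  have h2 : ⁅s * n, t * k⁆ = ⁅s, t⁆ := by
    have hn' : ∀ g, g * n = n * g := Subgroup.mem_center_iff.1 hn
    have hk' : ∀ g, g * k = k * g := Subgroup.mem_center_iff.1 hk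
    simp only [commutatorElement_def, mul_inv_rev]
    rw [hn' s, hk' t]
    calc n * s * (k * t) * (n⁻¹ * s⁻¹) * (k⁻¹ * t⁻¹)
        = n * (s * k) * t * (n⁻¹ * s⁻¹) * (k⁻¹ * t⁻¹) := by group
      _ = n * k * (s * t * n⁻¹ * s⁻¹ * k⁻¹) * t⁻¹ := by rw [hk' s]; group
      _ = n * k * ((s * t * n⁻¹ * s⁻¹) * k⁻¹) * t⁻¹ := by group
      _ = n * (k * (s * t * n⁻¹ * s⁻¹)) * k⁻¹ * t⁻¹ := by group
      _ = n * (s * t * n⁻¹) * s⁻¹ * t⁻¹ := by rw [← hk']; group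
      _ = s * t * s⁻¹ * t⁻¹ := by rw [← mul_assoc n, ← hn' (s * t)]; group
  rw [h2]
  exact (T.map (liftedToG τ)).mul_mem ((T.map _).mul_mem ((T.map _).mul_mem hs ht)
    ((T.map _).inv_mem hs)) ((T.map _).inv_mem ht)

variable [T2Space G] [LocallyCompactSpace G] [LocallyConnectedSpace G]

theorem exists_lift_oneParameter_liftedPairs (hZ : Finite (Subgroup.center G)) {d : ℕ}
    {τ : G →* PGL(d, ℝ)} (hτ : Continuous τ) {c : ℝ → SL(2, ℝ)} (hc : Continuous c)
    (hcm : ∀ s t, c (s + t) = c s * c t) :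
    ∃ c' : ℝ → liftedPairs τ, Continuous c' ∧ (∀ s t, c' (s + t) = c' s * c' t) ∧
      ∀ t, liftedToSL τ (c' t) = c t := by
  obtain ⟨x, hx, hxm, hxc⟩ := exists_lift_oneParameter (pairSnd G) continuous_pairSnd
    (hA.isOpenMap_pairSnd hG) (hA.surjective_pairSnd hG) (hA.finite_ker_pairSnd hG hZ) c hc hcm
  obtain ⟨y, hy, hym, hyc⟩ := exists_lift_oneParameter (unimodularToPGL d)
    continuous_unimodularToPGL isOpenMap_unimodularToPGL surjective_unimodularToPGL
    finite_ker_unimodularToPGL (fun t => τ (pairFst G (x t)))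
    (hτ.comp (continuous_pairFst.comp hx)) fun s t => by rw [hxm, map_mul, map_mul]
  refine ⟨fun t => ⟨(x t, y t), mem_liftedPairs.2 (hyc t).symm⟩,
    (hx.prodMk hy).subtype_mk _, fun s t => ?_, hxc⟩
  exact Subtype.ext (Prod.ext (hxm s t) (hym s t))

/-- The image of a continuous projective representation of `G` is generated by exponentials of
matrices that satisfy the relations of `𝔰𝔩₂`. -/
theorem exists_isGeneratedBySl2 (hZ : Finite (Subgroup.center G)) {d : ℕ} {τ : G →* PGL(d, ℝ)}
    (hτ : Continuous τ) : ∃ E F H, IsGeneratedBySl2 (Set.range τ) E F H := by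
  obtain ⟨U, hU, hUm, hfU⟩ := hA.exists_lift_oneParameter_liftedPairs hG hZ hτ
    continuous_sl2Upper sl2Upper_add
  obtain ⟨V, hV, hVm, hfV⟩ := hA.exists_lift_oneParameter_liftedPairs hG hZ hτ
    continuous_sl2Lower sl2Lower_add
  obtain ⟨D, hD, hDm, hfD⟩ := hA.exists_lift_oneParameter_liftedPairs hG hZ hτ
    continuous_sl2Diag sl2Diag_add
  obtain ⟨E, F, H, hrel, hE, hF⟩ := exists_sl2Relations (liftedToSL τ)
    (hA.finite_ker_liftedToSL hG hZ τ) (liftedToGL τ) (continuous_liftedToGL τ) hU hV hD hUm hVm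
    hDm hfU hfV hfD
  refine ⟨E, F, H, hrel, ?_⟩
  let T : Subgroup (liftedPairs τ) := Subgroup.closure (Set.range U ∪ Set.range V)
  have hTSL : T.map (liftedToSL τ) = ⊤ := eq_top_of_upper_lower_mem
    (fun s => ⟨U s, Subgroup.subset_closure (Or.inl ⟨s, rfl⟩), hfU s⟩)
    fun s => ⟨V s, Subgroup.subset_closure (Or.inr ⟨s, rfl⟩), hfV s⟩
  have hTGL : T.map (liftedToGL τ) = expSubgroup E F := by
    rw [MonoidHom.map_closure, expSubgroup]
    congr 1
    ext A
    constructor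
    · rintro ⟨_, ⟨s, rfl⟩ | ⟨s, rfl⟩, rfl⟩
      · exact ⟨s, Or.inl (hE s)⟩
      · exact ⟨s, Or.inr (hF s)⟩
    · rintro ⟨s, h | h⟩
      · exact ⟨U s, Or.inl ⟨s, rfl⟩, Units.ext ((hE s).trans h.symm)⟩
      · exact ⟨V s, Or.inr ⟨s, rfl⟩, Units.ext ((hF s).trans h.symm)⟩
  have hTG := hA.map_liftedToG_eq_top hG hTSL
  rw [← hTGL]
  ext g
  constructor
  · rintro ⟨_, ⟨t, -, rfl⟩, rfl⟩
    exact ⟨_, (mk_liftedToGL τ t).symm⟩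
  · rintro ⟨g, rfl⟩
    obtain ⟨t, ht, rfl⟩ : g ∈ T.map (liftedToG τ) := hTG ▸ Subgroup.mem_top g
    exact ⟨_, ⟨t, ht, rfl⟩, mk_liftedToGL τ t⟩

end IsProperIsometricAction
end Representation

/-! ### The action on `G ⧸ K` -/

section Quotient

open UpperHalfPlane

/-- The action on the upper half plane transported from `G ⧸ K`. -/
abbrev transportedAction {G : Type*} [Group G] {K : Subgroup G} (e : G ⧸ K ≃ ℍ) :
    MulAction G ℍ where
  smul g z := e (g • e.symm z)
  one_smul z := by
    change e ((1 : G) • e.symm z) = z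
    rw [one_smul, e.apply_symm_apply]
  mul_smul g h z := by
    change e ((g * h) • e.symm z) = e (g • e.symm (e (h • e.symm z)))
    rw [e.symm_apply_apply, mul_smul]

/-- The action is proper because `K` is compact. -/
theorem isProperIsometricAction_transported {G : Type*} [Group G] [TopologicalSpace G]
    [IsTopologicalGroup G] {K : Subgroup G} (hK : IsCompact (K : Set G))
    (e : G ⧸ K ≃ₜ ℍ)
    (he : ∀ (g : G) (x y : G ⧸ K), dist (e (g • x)) (e (g • y)) = dist (e x) (e y)) :
    let _ := transportedAction e.toEquiv
    IsProperIsometricAction G := by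
  let _ := transportedAction e.toEquiv
  have hsmul : ∀ (g : G) (z : ℍ), g • z = e (g • e.symm z) := fun _ _ => rfl
  refine ⟨?_, fun g z w => ?_, fun z w => ?_, fun C hC => ?_⟩
  · simp only [hsmul]
    exact e.continuous.comp (continuous_fst.smul (e.symm.continuous.comp continuous_snd))
  · rw [hsmul, hsmul, he, e.apply_symm_apply, e.apply_symm_apply]
  · obtain ⟨g, hg⟩ := MulAction.exists_smul_eq G (e.symm z) (e.symm w)
    exact ⟨g, by rw [hsmul, hg, e.apply_symm_apply]⟩
  · have hmk : IsProperMap (QuotientGroup.mk : G → G ⧸ K) := by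
      refine isProperMap_iff_isClosedMap_and_compact_fibers.2 ⟨QuotientGroup.continuous_mk,
        QuotientGroup.isClosedMap_coe hK, fun y => ?_⟩
      obtain ⟨g, rfl⟩ := QuotientGroup.mk_surjective y
      convert hK.image (continuous_const_mul g) using 1
      ext h
      rw [Set.mem_preimage, Set.mem_singleton_iff, eq_comm, QuotientGroup.eq]
      exact ⟨fun hh => ⟨_, hh, mul_inv_cancel_left _ _⟩, fun ⟨k, hk, hh⟩ => by
        rw [← hh, inv_mul_cancel_left]; exact hk⟩
    obtain ⟨g₀, hg₀⟩ := QuotientGroup.mk_surjective (e.symm I)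
    have h1 := ((hmk.isCompact_preimage (e.isCompact_preimage.2 hC)).image
      (continuous_mul_const g₀⁻¹))
    convert h1 using 1
    ext g
    rw [Set.mem_ofPred_eq, hsmul, ← hg₀]
    constructor
    · exact fun h => ⟨g * g₀, h, mul_inv_cancel_right _ _⟩
    · rintro ⟨h, hh, rfl⟩
      rw [MulAction.Quotient.smul_mk, smul_eq_mul, inv_mul_cancel_right]
      exact hh

end Quotient
end RankOneRep

theorem proposition11p2
    {E : Type*} [NormedAddCommGroup E] [NormedSpace ℝ E] [FiniteDimensional ℝ E]
    {G : Type*} [Group G] [TopologicalSpace G] [T2Space G] [ChartedSpace E G]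
    [LieGroup 𝓘(ℝ, E) ∞ G]
    (hsimple : RankOneRep.IsSimpleLie G) (hcenter : Finite (Subgroup.center G))
    (K : Subgroup G) (hK : RankOneRep.IsMaximalCompact K)
    (hX : RankOneRep.QuotientIsHyperbolicPlane (E := E) K)
    (d : ℕ) (τ : G →* Matrix.ProjGenLinGroup (Fin d) ℝ) (hτ : Continuous τ)
    (hprox : ∃ g : G, RankOneRep.IsProximal (τ g))
    (m : ℕ) (V : Fin m → Submodule ℝ (Fin d → ℝ))
    (hV : DirectSum.IsInternal V)
    (hirr : ∀ j, RankOneRep.IsIrreducibleSubspace (Set.range τ) (V j)) :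
    RankOneRep.PreservesProperlyConvexDomain (Set.range τ) ↔
      Odd (Finset.univ.sup fun j => Module.finrank ℝ (V j)) := by
  have : IsTopologicalGroup G := topologicalGroup_of_lieGroup 𝓘(ℝ, E) ∞
  have : LocallyCompactSpace G := ChartedSpace.locallyCompactSpace E G
  have : LocallyConnectedSpace G := ChartedSpace.locallyConnectedSpace E G
  obtain ⟨e, -, he⟩ := hX
  let _ := RankOneRep.transportedAction e.toEquiv
  have hA := RankOneRep.isProperIsometricAction_transported hK.prop e he
  obtain ⟨X, Y, H, h⟩ := hA.exists_isGeneratedBySl2 hsimple hcenter hτ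
  exact h.preservesProperlyConvexDomain_iff hV.submodule_iSup_eq_top hirr
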